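/- Let $X$ be a set of problems and $\Sigma$ a set of reasoning steps. A verifier is a map $h : X\times\Sigma^*\to\{\mathrm{YES},\mathrm{NO}\}$; for $\tau=(x_1,\dots,x_t)$ write $\tau_j=(x_1,\dots,x_j)$. Let $\mathsf f(h,(x_0,\tau))$ be the smallest $j\in\{1,\dots,t\}$ with $h(x_0,\tau_j)=\mathrm{NO}$, and $t$ if there is none. With respect to a correct verifier $h^*$, the label of $(x_0,\tau)$ tells whether $h^*(x_0,\tau_j)=\mathrm{YES}$ for all $1\le j\le t$, and gives $\mathsf f(h^*,(x_0,\tau))$ (the first faulty step, if the trace is faulty); a verifier $h$ errs on $(x_0,\tau)$ if $h(x_0,\tau_j)\ne h^*(x_0,\tau_j)$ for some $1\le j\le \mathsf f(h^*,(x_0,\tau))$. A learner maps every finite labelled sample of traces to a verifier, which need not belong to the given class. A learner SVPAC-learns a class $H$ of verifiers, for a family $\mathcal D$ of distributions on $X\times\Sigma^*$, with sample size $M(\epsilon,\delta)$ if for all $h^*\in H$, all $\epsilon,\delta\in(0,1)$, all $D\in\mathcal D$ and all integers $m\ge M(\epsilon,\delta)$: when it is given $m$ i.i.d. draws from $D$,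 labelled by $h^*$, it outputs with probability at least $1-\delta$ a verifier $h$ with $\Pr_{z\sim D}[h\text{ errs on }z]\le\epsilon$. **Theorem.** There is an absolute constant $C>0$ such that the following holds. Let $H$ be a class of verifiers on $X\times\Sigma^*$ of finite VC dimension $d=\mathsf{VCDim}(H)$, let $T\ge 2$, and put $$M(\epsilon,\delta)=\frac{C}{\epsilon}\Big(d\log T+\log\frac1\delta\Big).$$ 1. Some learner SVPAC-learns $H$ with sample size $M(\epsilon,\delta)$ for all discrete distributions on $X\times\Sigma^*$ that are supported on traces of length at most $T$. 2. Suppose that $X$ and $\Sigma$ are measurable spaces, that every $h\in H$ is measurable, and that $H$ is separable for pointwise convergence, i.e. some countable $H_0\subseteq H$ contains, for every $h\in H$ and every finite $F\subseteq X\times\Sigma^*$, a verifier that agrees with $h$ on $F$. Then some learner SVPAC-learns $H$ with sample size $M(\epsilon,\delta)$ for all probability measures on $X\times\Sigma^*$ that are concentrated on traces of length at most $T$. -/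

import Mathlib

open MeasureTheory

namespace SVPAC

universe u v

/-- A problem together with a finite reasoning trace: an element of `X × Σ*`. -/
abbrev ProblemTrace (X : Type u) (Step : Type v) : Type (max u v) := X × List Step

/-- A verifier is a map `X × Σ* → {YES, NO}`, with `true = YES` and `false = NO`. -/
abbrev Verifier (X : Type u) (Step : Type v) : Type (max u v) := ProblemTrace X Step → Bool

variable {X : Type u} {Step : Type v}

/-- The sub-trace `(x₀, (x₁, …, x_j))` of `(x₀, (x₁, …, x_t))`, for `j ≤ t`. -/
def subtrace (z : ProblemTrace X Step) (j : ℕ) : ProblemTrace X Step := (z.1, z.2.take j)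

/-- `H` shatters the finite set `F`: every YES/NO labelling of `F` is realized by some `h ∈ H`
(`G` is the set of points labelled YES). -/
def Shatters (H : Set (Verifier X Step)) (F : Finset (ProblemTrace X Step)) : Prop :=
  ∀ G ⊆ F, ∃ h ∈ H, ∀ z ∈ F, (h z = true ↔ z ∈ G)

/-- The VC dimension of a class of verifiers: the supremum of the sizes of the finite sets that it
shatters, `⊤` if these sizes are unbounded. -/
noncomputable def vcDim (H : Set (Verifier X Step)) : ℕ∞ :=
  ⨆ (F : Finset (ProblemTrace X Step)) (_ : Shatters H F), (F.card : ℕ∞)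

/-- The index at which `h` stops on `(x₀, (x₁, …, x_t))`: the smallest `j ∈ {1, …, t}` such that
`h (x₀, (x₁, …, x_j)) = NO`, and `t` if there is none. -/
noncomputable def stopIndex (h : Verifier X Step) (z : ProblemTrace X Step) : ℕ :=
  sInf ({j : ℕ | 1 ≤ j ∧ j ≤ z.2.length ∧ h (subtrace z j) = false} ∪ {z.2.length})

open Classical in
/-- The label of a trace: whether all its steps are legitimate according to `h`, together with the
index at which `h` stops (for a faulty trace this is the first faulty step). -/
noncomputable def label (h : Verifier X Step) (z : ProblemTrace X Step) : Bool × ℕ :=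
  (decide (∀ j, 1 ≤ j → j ≤ z.2.length → h (subtrace z j) = true), stopIndex h z)

/-- `h` errs on `z` with respect to the correct verifier `hstar`. -/
def Errs (hstar h : Verifier X Step) (z : ProblemTrace X Step) : Prop :=
  ∃ j, 1 ≤ j ∧ j ≤ stopIndex hstar z ∧ h (subtrace z j) ≠ hstar (subtrace z j)

/-- A learner maps a labelled sample of any size `m` to a verifier (not necessarily in `H`). -/
abbrev Learner (X : Type u) (Step : Type v) : Type (max u v) :=
  (m : ℕ) → (Fin m → ProblemTrace X Step × (Bool × ℕ)) → Verifier X Step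

/-- The learner `A` simply-verifiably-PAC learns `H`, with respect to the distributions in `𝒟`,
with sample size `M ε δ`: for every `hstar ∈ H`, all `ε, δ ∈ (0, 1)`, every distribution `D ∈ 𝒟`
and every sample size `m ≥ M ε δ`, if `m` traces are drawn i.i.d. from `D` and labelled by `hstar`,
then the probability that the learned verifier has error more than `ε` over `D` is at most `δ`.
On a set that is not measurable, a measure is the outer measure, so no measurability of the learner
is presupposed. -/
def SVPACLearns {mZ : MeasurableSpace (ProblemTrace X Step)} (A : Learner X Step)
    (H : Set (Verifier X Step)) (𝒟 : Set (Measure (ProblemTrace X Step)))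
    (M : ℝ → ℝ → ℝ) : Prop :=
  ∀ hstar ∈ H, ∀ ε δ : ℝ, 0 < ε → ε < 1 → 0 < δ → δ < 1 → ∀ D ∈ 𝒟, ∀ m : ℕ, M ε δ ≤ (m : ℝ) →
    (Measure.pi fun _ : Fin m => D)
      {S | ENNReal.ofReal ε < D {z | Errs hstar (A m fun i => (S i, label hstar (S i))) z}}
      ≤ ENNReal.ofReal δ

/-- The discrete distributions on `X × Σ*` (every set is measurable for them) whose traces have
length at most `T`. -/
def discreteLaws (X : Type u) (Step : Type v) (T : ℕ) :
    Set (@Measure (ProblemTrace X Step) ⊤) :=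
  {D | ∃ p : PMF (ProblemTrace X Step),
    D = @PMF.toMeasure (ProblemTrace X Step) ⊤ p ∧ ∀ z ∈ p.support, z.2.length ≤ T}

/-- The usual σ-algebra on `Σ*`, seen as the disjoint union of the powers `Σⁿ`: a set of finite
sequences is measurable iff for every `n` its members of length `n` form a measurable subset of the
product space `Σⁿ`. -/
instance instMeasurableSpaceTraces [MeasurableSpace Step] : MeasurableSpace (List Step) :=
  ⨅ n : ℕ, MeasurableSpace.map (fun v : Fin n → Step => List.ofFn v) MeasurableSpace.pi

/-- All probability measures on `X × Σ*` that are concentrated on traces of length at most `T`. -/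
def boundedLaws (X : Type u) (Step : Type v) [MeasurableSpace X] [MeasurableSpace Step] (T : ℕ) :
    Set (Measure (ProblemTrace X Step)) :=
  {D | IsProbabilityMeasure D ∧ ∀ᵐ z ∂D, z.2.length ≤ T}

/-- `H` is separable for pointwise convergence: there is a countable subclass of `H` that contains,
for every `h ∈ H` and every finite set of points, a verifier that agrees with `h` on that set. -/
def PointwiseSeparable (H : Set (Verifier X Step)) : Prop :=
  ∃ H₀ ⊆ H, H₀.Countable ∧
    ∀ h ∈ H, ∀ F : Finset (ProblemTrace X Step), ∃ h₀ ∈ H₀, ∀ z ∈ F, h₀ z = h z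

end SVPAC

/-! The learner is Hanneke's optimal PAC learner, a majority vote over overlapping subsamples,
analysed through error sets. Fix `hstar`. Each `h ∈ H` gives the set of traces on which it errs, and
`h` is consistent with a sample exactly when this set avoids the sample. If the pointwise vote errs
on a trace at some prefix, then at least half of the voters err on that trace at the same prefix.
Its error set therefore lies in the `majoritySet` of theirs (`le_countP_errs`), and the rest
concerns sets only.

The combinatorial input is the number of patterns that error sets cut out on `n` traces. A pattern
is determined by the values of `h` on at most `nT` prefixes, so Sauer–Shelah gives at most `(T/β)^d
* exp (β n)` patterns (`growthBound_errorSet`). For constant `β` the prefactor is `exp (O(d log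
T))`. The factor `exp (β n)` is made harmless by localization: inside a set `E` of measure `p`, only
the roughly `p n` sample points that fall in `E` count. A rule consistent with `n` examples then
has, with probability `1 - η`, an error set that meets `E` in measure of order `(log K + β p n + log
(1/η)) / n` (`measure_exists_consistent_le`). With `p` of order `1/n` no logarithm of `1/ε` appears.

The recursion (`measure_majoritySet_subsamples_le`) joins three votes, each blind to one block of `n
= 4 ^ k` examples that every voter of the other two sees. Conditionally on the examples outside the
block, the region where the blind vote is wrong is a fixed set, small by induction, and the other
voters are consistent with `n` fresh examples. Hence the overlaps are small (`measure_overlap_le`).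
They control the joint vote (`measureReal_majoritySet_append_le`) with a constant small enough to
close the induction at `4n`.

Suprema run only over the countably many rules in play, never over `H`, so joint measurability of
the selected verifier suffices. It is automatic on a countable support; for a separable class it
comes from choosing the first consistent verifier of an enumeration. -/

namespace SVPAC

universe u v

/-! ### Localized uniform convergence for consistent rules -/

section Localized

open scoped ENNReal

variable {Z : Type*}

/-- On every finite set `F`, the sets of the family `𝓑` have at most `K * exp (β * |F|)` traces. -/
def GrowthBound (𝓑 : Set (Set Z)) (K β : ℝ) : Prop :=
  ∀ F : Finset Z, ∃ 𝒢 : Finset (Set Z), (𝒢.card : ℝ) ≤ K * Real.exp (β * F.card) ∧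
    ∀ b ∈ 𝓑, ∃ g ∈ 𝒢, ∀ z ∈ F, (z ∈ b ↔ z ∈ g)

open Classical in
/-- The weight of a pair of points with respect to a set `g`: it vanishes if the first point lies
in `g`, and otherwise doubles if the second one does. -/
noncomputable def pairWeight (g : Set Z) (q : Z × Z) : ℝ≥0∞ :=
  (if q.1 ∈ g then 0 else 1) * (if q.2 ∈ g then 2 else 1)

lemma pairWeight_add_swap_le (g : Set Z) (q : Z × Z) :
    pairWeight g q.swap + pairWeight g q ≤ 2 := by
  unfold pairWeight
  by_cases h1 : q.1 ∈ g <;> by_cases h2 : q.2 ∈ g <;> simp [h1, h2, one_add_one_eq_two]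

lemma pairWeight_congr {g g' : Set Z} {q : Z × Z} (h1 : q.1 ∈ g ↔ q.1 ∈ g')
    (h2 : q.2 ∈ g ↔ q.2 ∈ g') : pairWeight g q = pairWeight g' q := by
  by_cases a : q.1 ∈ g' <;> by_cases b : q.2 ∈ g' <;> simp [pairWeight, h1, h2, a, b]

/-- Swap the two points of those pairs that `σ` selects. -/
def swapAt {ι : Type*} (σ : ι → Bool) (q : ι → Z × Z) (i : ι) : Z × Z :=
  if σ i then (q i).swap else q i

/-- The sum over all swaps factorizes into one sum of two terms per pair, and each of these is at
most 2. -/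
lemma sum_prod_pairWeight_swapAt_le {ι : Type*} [Fintype ι] [DecidableEq ι] (g : Set Z)
    (q : ι → Z × Z) :
    ∑ σ : ι → Bool, ∏ i, pairWeight g (swapAt σ q i) ≤ 2 ^ Fintype.card ι := by
  have h := Finset.prod_univ_sum (fun _ : ι => (Finset.univ : Finset Bool))
    (fun i b => pairWeight g (if b then (q i).swap else q i))
  rw [Fintype.piFinset_univ] at h
  simp only [swapAt]
  rw [← h]
  calc ∏ i, ∑ b : Bool, pairWeight g (if b then (q i).swap else q i)
      ≤ ∏ _i : ι, (2 : ℝ≥0∞) := by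
        refine Finset.prod_le_prod' fun i _ => ?_
        simpa using pairWeight_add_swap_le g (q i)
    _ = 2 ^ Fintype.card ι := by simp

open Classical in
/-- The function `exp β` on `E` and `1` elsewhere. -/
noncomputable def expWeight (E : Set Z) (β : ℝ) (z : Z) : ℝ≥0∞ :=
  if z ∈ E then ENNReal.ofReal (Real.exp β) else 1

lemma expWeight_eq (E : Set Z) (β : ℝ) (z : Z) :
    expWeight E β z = ENNReal.ofReal (Real.exp (β * E.indicator 1 z)) := by
  by_cases h : z ∈ E <;> simp [expWeight, h]

/-- The selected set may depend on the swap `σ`, but the double sample as an unordered set does not.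
One finite family of patterns thus serves all `σ`, and a union bound over it reduces to a fixed set.
-/
lemma sum_iSup_prod_pairWeight_le {ι W : Type*} [Fintype ι] [DecidableEq ι] {𝓑 : Set (Set Z)}
    {K β : ℝ} (hK : 0 ≤ K) (hβ : 0 ≤ β) (hgrow : GrowthBound 𝓑 K β) (E : Set Z)
    {h : W → (ι → Z) → Set Z} (hB : ∀ w S, h w S ∈ 𝓑) (q : ι → Z × Z) :
    ∑ σ : ι → Bool, ⨆ w, ∏ i, pairWeight (h w (fun j => (swapAt σ q j).1) ∩ E) (swapAt σ q i)
      ≤ 2 ^ Fintype.card ι *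
        (ENNReal.ofReal K * ∏ i, (expWeight E β (q i).1 * expWeight E β (q i).2)) := by
  classical
  -- Points outside `E` do not affect the weights of sets cut down to `E`, so only patterns on the
  -- part inside `E` are counted. This is the localization.
  set F : Finset Z := (Finset.univ.biUnion fun i => {(q i).1, (q i).2}).filter (· ∈ E) with hF
  obtain ⟨𝒢, hcard, h𝒢⟩ := hgrow F
  have hmem1 (i : ι) (hi : (q i).1 ∈ E) : (q i).1 ∈ F := by
    simp only [hF, Finset.mem_filter, Finset.mem_biUnion]
    exact ⟨⟨i, Finset.mem_univ _, by simp⟩, hi⟩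
  have hmem2 (i : ι) (hi : (q i).2 ∈ E) : (q i).2 ∈ F := by
    simp only [hF, Finset.mem_filter, Finset.mem_biUnion]
    exact ⟨⟨i, Finset.mem_univ _, by simp⟩, hi⟩
  have hFcard : (F.card : ℝ) ≤ ∑ i, (E.indicator 1 (q i).1 + E.indicator 1 (q i).2 : ℝ) := by
    have h1 : F.card ≤ ∑ i, (({(q i).1, (q i).2} : Finset Z).filter (· ∈ E)).card := by
      rw [hF, Finset.filter_biUnion]
      exact Finset.card_biUnion_le
    calc (F.card : ℝ) ≤ ∑ i, ((({(q i).1, (q i).2} : Finset Z).filter (· ∈ E)).card : ℝ) := by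
          exact_mod_cast h1
      _ ≤ _ := by
          refine Finset.sum_le_sum fun i _ => ?_
          rw [Finset.filter_insert, Finset.filter_singleton]
          by_cases h1 : (q i).1 ∈ E <;> by_cases h2 : (q i).2 ∈ E <;> simp [h1, h2]
          have := Finset.card_le_two (a := (q i).1) (b := (q i).2)
          norm_num
          exact_mod_cast this
  have hexp : ENNReal.ofReal (Real.exp (β * F.card))
      ≤ ∏ i, (expWeight E β (q i).1 * expWeight E β (q i).2) := by
    simp only [expWeight_eq]
    simp_rw [← ENNReal.ofReal_mul (Real.exp_nonneg _), ← Real.exp_add, ← mul_add]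
    rw [← ENNReal.ofReal_prod_of_nonneg (fun i _ => Real.exp_nonneg _), ← Real.exp_sum,
      ← Finset.mul_sum]
    exact ENNReal.ofReal_le_ofReal (Real.exp_le_exp.2 (mul_le_mul_of_nonneg_left hFcard hβ))
  calc ∑ σ : ι → Bool, ⨆ w, ∏ i,
        pairWeight (h w (fun j => (swapAt σ q j).1) ∩ E) (swapAt σ q i)
      ≤ ∑ σ : ι → Bool, ∑ g ∈ 𝒢, ∏ i, pairWeight (g ∩ E) (swapAt σ q i) := by
        refine Finset.sum_le_sum fun σ _ => iSup_le fun w => ?_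
        obtain ⟨g, hg, hgF⟩ := h𝒢 _ (hB w fun j => (swapAt σ q j).1)
        have hiff1 (i : ι) : (q i).1 ∈ h w (fun j => (swapAt σ q j).1) ∩ E ↔ (q i).1 ∈ g ∩ E :=
          and_congr_left fun hE => hgF _ (hmem1 i hE)
        have hiff2 (i : ι) : (q i).2 ∈ h w (fun j => (swapAt σ q j).1) ∩ E ↔ (q i).2 ∈ g ∩ E :=
          and_congr_left fun hE => hgF _ (hmem2 i hE)
        have : ∏ i, pairWeight (h w (fun j => (swapAt σ q j).1) ∩ E) (swapAt σ q i)
            = ∏ i, pairWeight (g ∩ E) (swapAt σ q i) := by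
          refine Finset.prod_congr rfl fun i _ => ?_
          have hsw : swapAt σ q i = (q i).swap ∨ swapAt σ q i = q i := by
            unfold swapAt; split <;> simp
          rcases hsw with e | e <;> rw [e]
          · exact pairWeight_congr (hiff2 i) (hiff1 i)
          · exact pairWeight_congr (hiff1 i) (hiff2 i)
        rw [this]
        exact Finset.single_le_sum (f := fun g => ∏ i, pairWeight (g ∩ E) (swapAt σ q i))
          (fun _ _ => zero_le) hg
    _ = ∑ g ∈ 𝒢, ∑ σ : ι → Bool, ∏ i, pairWeight (g ∩ E) (swapAt σ q i) := Finset.sum_comm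
    _ ≤ ∑ _g ∈ 𝒢, 2 ^ Fintype.card ι :=
        Finset.sum_le_sum fun g _ => sum_prod_pairWeight_swapAt_le _ q
    _ = 2 ^ Fintype.card ι * ENNReal.ofReal 𝒢.card := by
        rw [Finset.sum_const, nsmul_eq_mul, mul_comm, ENNReal.ofReal_natCast]
    _ ≤ _ := by
        gcongr
        refine (ENNReal.ofReal_le_ofReal hcard).trans ?_
        rw [ENNReal.ofReal_mul hK]
        gcongr

lemma measurable_pairWeight_comp {Ω : Type*} [MeasurableSpace Ω] {g : Ω → Set Z} {f : Ω → Z × Z}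
    (h1 : MeasurableSet {ω | (f ω).1 ∈ g ω}) (h2 : MeasurableSet {ω | (f ω).2 ∈ g ω}) :
    Measurable fun ω => pairWeight (g ω) (f ω) := by
  classical
  unfold pairWeight
  refine Measurable.mul ?_ ?_
  · convert Measurable.ite h1 (measurable_const (a := (0 : ℝ≥0∞)))
      (measurable_const (a := (1 : ℝ≥0∞))) using 1
  · convert Measurable.ite h2 (measurable_const (a := (2 : ℝ≥0∞)))
      (measurable_const (a := (1 : ℝ≥0∞))) using 1

/-! ### Integration over i.i.d. samples and symmetrization -/

variable [MeasurableSpace Z] (D : Measure Z) [IsProbabilityMeasure D]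

lemma lintegral_pi_prod {ι : Type*} [Fintype ι] {f : ι → Z → ℝ≥0∞} (hf : ∀ i, Measurable (f i)) :
    ∫⁻ S, ∏ i, f i (S i) ∂(Measure.pi fun _ : ι => D) = ∏ i, ∫⁻ z, f i z ∂D := by
  have hind := ProbabilityTheory.iIndepFun_pi (μ := fun _ : ι => D) (X := f)
    (fun i => (hf i).aemeasurable)
  rw [ProbabilityTheory.lintegral_prod_eq_prod_lintegral_of_indepFun Finset.univ _ hind
    (fun i => (hf i).comp (measurable_pi_apply i))]
  refine Finset.prod_congr rfl fun i _ => ?_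
  exact (measurePreserving_eval (fun _ : ι => D) i).lintegral_comp (hf i)

lemma measurable_expWeight {E : Set Z} (hE : MeasurableSet E) (β : ℝ) :
    Measurable (expWeight E β) :=
  Measurable.ite hE measurable_const measurable_const

/-- The integral is `1 + (exp β - 1) * D E`, and `exp β - 1 ≤ β + β² ≤ 2β` on `[0, 1]`. -/
lemma lintegral_expWeight_le {E : Set Z} (hE : MeasurableSet E) {p β : ℝ} (hβ : 0 ≤ β)
    (hβ1 : β ≤ 1) (hp : D.real E ≤ p) :
    ∫⁻ z, expWeight E β z ∂D ≤ ENNReal.ofReal (Real.exp (2 * β * p)) := by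
  have h0 : 0 ≤ Real.exp β - 1 := by linarith [Real.add_one_le_exp β]
  have h1 : Real.exp β - 1 ≤ 2 * β := by
    have := Real.abs_exp_sub_one_sub_id_le (x := β) (by rw [abs_of_nonneg hβ]; exact hβ1)
    have := (abs_le.1 this).2
    nlinarith
  have heq : expWeight E β = fun z =>
      1 + E.indicator (fun _ => ENNReal.ofReal (Real.exp β - 1)) z := by
    funext z
    by_cases h : z ∈ E
    · simp only [expWeight, h, if_true, Set.indicator_of_mem]
      rw [← ENNReal.ofReal_one, ← ENNReal.ofReal_add zero_le_one h0]
      congr 1; ring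
    · simp [expWeight, h]
  rw [heq, lintegral_add_left measurable_const, lintegral_const, measure_univ,
    lintegral_indicator_const hE, ← ofReal_measureReal (μ := D) (s := E), ← ENNReal.ofReal_mul h0,
    mul_one, ← ENNReal.ofReal_one, ← ENNReal.ofReal_add zero_le_one (by positivity)]
  refine ENNReal.ofReal_le_ofReal ?_
  have h2 := Real.add_one_le_exp (2 * β * p)
  have h3 : (Real.exp β - 1) * D.real E ≤ 2 * β * p :=
    mul_le_mul h1 hp measureReal_nonneg (by positivity)
  linarith

lemma measurePreserving_swapAt {ι : Type*} [Fintype ι] (σ : ι → Bool) :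
    MeasurePreserving (swapAt (Z := Z) σ) (Measure.pi fun _ : ι => D.prod D)
      (Measure.pi fun _ : ι => D.prod D) := by
  refine measurePreserving_pi (fun _ : ι => D.prod D) (fun _ => D.prod D)
    (f := fun i x => if σ i then x.swap else x) fun i => ?_
  by_cases h : σ i
  · simpa [h] using! Measure.measurePreserving_swap (μ := D) (ν := D)
  · simpa [h] using! MeasurePreserving.id (D.prod D)

/-- Let `h w S` be countably many sets of a family with bounded growth that all avoid the sample
`S`. It is unlikely that some `h w S` has a large part in a given set `E` of small measure. -/
theorem measure_exists_consistent_le {ι W : Type*} [Fintype ι] [Countable W] {𝓑 : Set (Set Z)}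
    {K β p ε : ℝ} (hK : 0 ≤ K) (hβ : 0 ≤ β) (hβ1 : β ≤ 1) (hε : 0 ≤ ε)
    (hgrow : GrowthBound 𝓑 K β) {E : Set Z} (hE : MeasurableSet E) (hp : D.real E ≤ p)
    {h : W → (ι → Z) → Set Z} (hB : ∀ w S, h w S ∈ 𝓑)
    (hmeas : ∀ w, MeasurableSet {x : (ι → Z) × Z | x.2 ∈ h w x.1})
    (hcons : ∀ w S i, S i ∉ h w S) :
    ENNReal.ofReal ((1 + ε) ^ Fintype.card ι) *
        (Measure.pi fun _ : ι => D) {S | ∃ w, ε < D.real (h w S ∩ E)}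
      ≤ ENNReal.ofReal (K * Real.exp (4 * β * p * Fintype.card ι)) := by
  classical
  set Φ : (ι → Z × Z) → ℝ≥0∞ := fun q => ⨆ w, ∏ i, pairWeight (h w (fun j => (q j).1) ∩ E) (q i)
    with hΦ
  have hΦm : Measurable Φ := by
    refine Measurable.iSup fun w => Finset.measurable_prod _ fun i _ => ?_
    refine measurable_pairWeight_comp ?_ ?_
    · have hm : Measurable fun q : ι → Z × Z => ((fun j => (q j).1), (q i).1) := by fun_prop
      have hm' : Measurable fun q : ι → Z × Z => (q i).1 := by fun_prop
      exact (hm (hmeas w)).inter (hm' hE)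
    · have hm : Measurable fun q : ι → Z × Z => ((fun j => (q j).1), (q i).2) := by fun_prop
      have hm' : Measurable fun q : ι → Z × Z => (q i).2 := by fun_prop
      exact (hm (hmeas w)).inter (hm' hE)
  set μ := Measure.pi fun _ : ι => D with hμ
  set μ₂ := Measure.pi fun _ : ι => D.prod D with hμ₂
  -- the double sample
  have hpair : ∫⁻ q, Φ q ∂μ₂ = ∫⁻ S, ∫⁻ S', Φ (fun i => (S i, S' i)) ∂μ ∂μ := by
    have hmp := (measurePreserving_arrowProdEquivProdArrow Z Z ι (fun _ => D) (fun _ => D)).symm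
    rw [← hmp.lintegral_comp hΦm]
    exact lintegral_prod _ (hΦm.comp hmp.measurable).aemeasurable
  have hlower : ENNReal.ofReal ((1 + ε) ^ Fintype.card ι) * μ {S | ∃ w, ε < D.real (h w S ∩ E)}
      ≤ ∫⁻ q, Φ q ∂μ₂ := by
    rw [hpair]
    have hm2 : Measurable fun x : (ι → Z) × (ι → Z) => Φ (fun i => (x.1 i, x.2 i)) :=
      hΦm.comp (by fun_prop)
    -- Markov's inequality in the first half of the double sample: for every bad `S`, the integral
    -- over the ghost sample `S'` is at least `(1 + ε) ^ n`, where `n` is the sample size.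
    refine le_trans ?_ (mul_meas_ge_le_lintegral hm2.lintegral_prod_right'
      (ENNReal.ofReal ((1 + ε) ^ Fintype.card ι)))
    gcongr with S
    rintro ⟨w, hw⟩
    have hmw : MeasurableSet (h w S ∩ E) :=
      ((measurable_prodMk_left (x := S)) (hmeas w)).inter hE
    calc ENNReal.ofReal ((1 + ε) ^ Fintype.card ι)
        = ∏ _i : ι, ENNReal.ofReal (1 + ε) := by
          rw [Finset.prod_const, Finset.card_univ, ENNReal.ofReal_pow (by positivity)]
      _ ≤ ∏ _i : ι, ∫⁻ z, (1 + (h w S ∩ E).indicator 1 z) ∂D := by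
          refine Finset.prod_le_prod' fun _ _ => ?_
          rw [lintegral_add_left measurable_const, lintegral_const, measure_univ,
            lintegral_indicator_one hmw, ENNReal.ofReal_add zero_le_one hε]
          simp only [ENNReal.ofReal_one, mul_one]
          gcongr
          rw [← ofReal_measureReal (μ := D)]
          exact ENNReal.ofReal_le_ofReal hw.le
      _ = ∫⁻ S', ∏ i, (1 + (h w S ∩ E).indicator 1 (S' i)) ∂μ :=
          (lintegral_pi_prod D
            fun _ => measurable_const.add (measurable_one.indicator hmw)).symm
      _ ≤ ∫⁻ S', Φ (fun i => (S i, S' i)) ∂μ := by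
          -- Consistency makes the first factor of every pair weight equal to 1; the second is 1
          -- plus the indicator at the ghost point.
          refine lintegral_mono fun S' => le_trans ?_ (le_iSup _ w)
          refine Finset.prod_le_prod' fun i _ => ?_
          have : S i ∉ h w S ∩ E := fun hh => hcons w S i hh.1
          by_cases h' : S' i ∈ h w S ∩ E
          · simp only [pairWeight, this, h', Set.indicator_of_mem, if_true, if_false, one_mul,
              Pi.one_apply, one_add_one_eq_two, le_refl]
          · simp only [pairWeight, this, h', Set.indicator_of_notMem, if_false, one_mul,
              add_zero, not_false_eq_true, le_refl]
  -- symmetrization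
  have hsymm : 2 ^ Fintype.card ι * ∫⁻ q, Φ q ∂μ₂
      = ∫⁻ q, ∑ σ : ι → Bool, Φ (swapAt σ q) ∂μ₂ := by
    rw [lintegral_finsetSum (f := fun σ q => Φ (swapAt σ q)) _
      (fun σ _ => hΦm.comp (measurePreserving_swapAt D σ).measurable)]
    have hσ (σ : ι → Bool) : ∫⁻ q, Φ (swapAt σ q) ∂μ₂ = ∫⁻ q, Φ q ∂μ₂ :=
      (measurePreserving_swapAt D σ).lintegral_comp hΦm
    simp [hσ]
  have hupper : ∫⁻ q, ∑ σ : ι → Bool, Φ (swapAt σ q) ∂μ₂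
      ≤ 2 ^ Fintype.card ι * ENNReal.ofReal (K * Real.exp (4 * β * p * Fintype.card ι)) := by
    have hem := measurable_expWeight hE β
    calc ∫⁻ q, ∑ σ : ι → Bool, Φ (swapAt σ q) ∂μ₂
        ≤ ∫⁻ q, 2 ^ Fintype.card ι * (ENNReal.ofReal K *
            ∏ i, (expWeight E β (q i).1 * expWeight E β (q i).2)) ∂μ₂ :=
          lintegral_mono fun q => sum_iSup_prod_pairWeight_le hK hβ hgrow E hB q
      _ = 2 ^ Fintype.card ι * (ENNReal.ofReal K *
            ∏ _i : ι, ((∫⁻ z, expWeight E β z ∂D) * ∫⁻ z, expWeight E β z ∂D)) := by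
          have hm : Measurable fun x : Z × Z => expWeight E β x.1 * expWeight E β x.2 :=
            (hem.comp measurable_fst).mul (hem.comp measurable_snd)
          rw [lintegral_const_mul _ (by fun_prop), lintegral_const_mul _ (by fun_prop),
            lintegral_pi_prod (D.prod D)
              (f := fun _ x => expWeight E β x.1 * expWeight E β x.2) (fun _ => hm),
            lintegral_prod_mul hem.aemeasurable hem.aemeasurable]
      _ ≤ 2 ^ Fintype.card ι * (ENNReal.ofReal K *
            ∏ _i : ι, (ENNReal.ofReal (Real.exp (2 * β * p)) *
              ENNReal.ofReal (Real.exp (2 * β * p)))) := by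
          gcongr <;> exact lintegral_expWeight_le D hE hβ hβ1 hp
      _ = _ := by
          rw [Finset.prod_const, Finset.card_univ, ← ENNReal.ofReal_mul (Real.exp_nonneg _),
            ← Real.exp_add, ← ENNReal.ofReal_pow (Real.exp_nonneg _), ← Real.exp_nat_mul,
            ← ENNReal.ofReal_mul hK]
          congr 4
          ring
  refine hlower.trans ?_
  have h2 : (2 : ℝ≥0∞) ^ Fintype.card ι ≠ 0 := by positivity
  have h2' : (2 : ℝ≥0∞) ^ Fintype.card ι ≠ ∞ := by finiteness
  rw [← ENNReal.mul_le_mul_iff_right h2 h2']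
  exact hsymm.trans_le hupper

end Localized

/-! ### Majority votes over overlapping subsamples -/

section Majority

open scoped ENNReal

variable {Z I : Type*}

open Classical in
/-- The points that lie in at least half of the sets `B J`, for `J` in the list `l`. -/
def majoritySet (B : Finset I → Set Z) (l : List (Finset I)) : Set Z :=
  {z | l.length ≤ 2 * l.countP (fun J => z ∈ B J)}

open Classical in
lemma sum_indicator_inter (B : Finset I → Set Z) (l : List (Finset I)) (E : Set Z) (z : Z) :
    (l.map fun J => (B J ∩ E).indicator (1 : Z → ℝ≥0∞) z).sum
      = E.indicator (fun z => (l.countP (fun J => z ∈ B J) : ℝ≥0∞)) z := by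
  induction l with
  | nil => by_cases h : z ∈ E <;> simp [h]
  | cons J l ih =>
    rw [List.map_cons, List.sum_cons, ih]
    by_cases h : z ∈ E <;> by_cases h' : z ∈ B J <;> simp [h, h', List.countP_cons, add_comm]

lemma measurable_countP {Ω : Type*} [MeasurableSpace Ω] {l : List (Finset I)}
    {p : Ω → Finset I → Bool} (hp : ∀ J ∈ l, MeasurableSet {ω | p ω J = true}) :
    Measurable fun ω => l.countP (p ω) := by
  induction l with
  | nil => simp
  | cons J l ih =>
    simp only [List.countP_cons]
    refine (ih fun J' hJ' => hp J' (List.mem_cons_of_mem _ hJ')).add ?_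
    exact Measurable.ite (hp J List.mem_cons_self) measurable_const measurable_const

lemma measurableSet_majoritySet {Ω : Type*} [MeasurableSpace Ω] {B : Ω → Finset I → Set Z}
    {f : Ω → Z} {l : List (Finset I)} (hB : ∀ J ∈ l, MeasurableSet {ω | f ω ∈ B ω J}) :
    MeasurableSet {ω | f ω ∈ majoritySet (B ω) l} := by
  classical
  have h : Measurable fun ω => 2 * l.countP (fun J => f ω ∈ B ω J) :=
    (measurable_countP (fun J hJ => by simpa using hB J hJ)).const_mul 2
  simpa only [majoritySet] using! measurableSet_le measurable_const h

variable [MeasurableSpace Z]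

variable (D : Measure Z) [IsProbabilityMeasure D]

lemma lintegral_sum_indicator_le {B : Finset I → Set Z} {E : Set Z} (hE : MeasurableSet E)
    {l : List (Finset I)} (hB : ∀ J ∈ l, MeasurableSet (B J)) {ε : ℝ}
    (hε : ∀ J ∈ l, D.real (B J ∩ E) ≤ ε) :
    ∫⁻ z, (l.map fun J => (B J ∩ E).indicator (1 : Z → ℝ≥0∞) z).sum ∂D
      ≤ l.length * ENNReal.ofReal ε := by
  induction l with
  | nil => simp
  | cons J l ih =>
    simp only [List.map_cons, List.sum_cons, List.length_cons]
    have hm := (hB J List.mem_cons_self).inter hE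
    rw [lintegral_add_left (measurable_one.indicator hm), lintegral_indicator_one hm,
      ← ofReal_measureReal (μ := D), Nat.cast_add, Nat.cast_one, add_mul, one_mul, add_comm]
    exact add_le_add (ih (fun J' h => hB J' (List.mem_cons_of_mem _ h))
      (fun J' h => hε J' (List.mem_cons_of_mem _ h)))
      (ENNReal.ofReal_le_ofReal (hε J List.mem_cons_self))

/-- If three votes of the same size overlap pairwise little, the joint vote is rarely wrong. -/
lemma measureReal_majoritySet_append_le {B : Finset I → Set Z} (hB : ∀ J, MeasurableSet (B J))
    {l₀ l₁ l₂ : List (Finset I)} {N : ℕ} (hN : 0 < N) (h₀ : l₀.length = N) (h₁ : l₁.length = N)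
    (h₂ : l₂.length = N) {ε : ℝ} (hε : 0 ≤ ε)
    (h0 : ∀ J ∈ l₁ ++ l₂, D.real (B J ∩ majoritySet B l₀) ≤ ε)
    (h1 : ∀ J ∈ l₀ ++ l₂, D.real (B J ∩ majoritySet B l₁) ≤ ε)
    (h2 : ∀ J ∈ l₀ ++ l₁, D.real (B J ∩ majoritySet B l₂) ≤ ε) :
    D.real (majoritySet B (l₀ ++ l₁ ++ l₂)) ≤ 12 * ε := by
  classical
  have hM (l : List (Finset I)) : MeasurableSet (majoritySet B l) :=
    measurableSet_majoritySet (B := fun _ : Z => B) (f := id) fun J _ => hB J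
  set S : List (Finset I) → Set Z → Z → ℝ≥0∞ := fun l E z =>
    (l.map fun J => (B J ∩ E).indicator (1 : Z → ℝ≥0∞) z).sum with hS
  have hSe (l : List (Finset I)) (E : Set Z) :
      S l E = E.indicator (fun z => ((l.countP fun J => z ∈ B J : ℕ) : ℝ≥0∞)) :=
    funext fun z => sum_indicator_inter B l E z
  have hSm (l : List (Finset I)) {E : Set Z} (hE : MeasurableSet E) : Measurable (S l E) := by
    rw [hSe]
    refine Measurable.indicator ?_ hE
    exact (measurable_of_countable (fun n : ℕ => (n : ℝ≥0∞))).comp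
      (measurable_countP fun J _ => by simpa using hB J)
  -- At least `3N/2` of the `3N` voters are wrong at `z`, so some vote has a wrong majority. If it
  -- is the only one, the other two still contribute at least `3N/2 - N = N/2` wrong voters. If
  -- there are two, each contributes at least `N/2` on the region of the other.
  have hpt (z : Z) : (majoritySet B (l₀ ++ l₁ ++ l₂)).indicator (fun _ => (N : ℝ≥0∞)) z ≤
      2 * (S (l₁ ++ l₂) (majoritySet B l₀) z + S (l₀ ++ l₂) (majoritySet B l₁) z
        + S (l₀ ++ l₁) (majoritySet B l₂) z) := by
    by_cases hz : z ∈ majoritySet B (l₀ ++ l₁ ++ l₂)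
    swap
    · rw [Set.indicator_of_notMem hz]
      exact zero_le
    rw [Set.indicator_of_mem hz]
    simp only [hSe, Set.indicator_apply, List.countP_append]
    simp only [majoritySet, Set.mem_ofPred_eq, List.length_append, List.countP_append, h₀, h₁, h₂]
      at hz ⊢
    have c₀ := List.countP_le_length (p := fun J => decide (z ∈ B J)) (l := l₀)
    have c₁ := List.countP_le_length (p := fun J => decide (z ∈ B J)) (l := l₁)
    have c₂ := List.countP_le_length (p := fun J => decide (z ∈ B J)) (l := l₂)
    rw [h₀] at c₀
    rw [h₁] at c₁
    rw [h₂] at c₂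
    norm_cast
    split_ifs <;> omega
  -- Each of the three sums has `2N` terms of integral at most `ε`; with the factor 2 this gives `12
  -- N ε`.
  have hint : N * D (majoritySet B (l₀ ++ l₁ ++ l₂)) ≤ N * ENNReal.ofReal (12 * ε) := by
    calc N * D (majoritySet B (l₀ ++ l₁ ++ l₂))
        = ∫⁻ z, (majoritySet B (l₀ ++ l₁ ++ l₂)).indicator (fun _ => (N : ℝ≥0∞)) z ∂D := by
          rw [lintegral_indicator_const (hM _)]
      _ ≤ ∫⁻ z, 2 * (S (l₁ ++ l₂) (majoritySet B l₀) z + S (l₀ ++ l₂) (majoritySet B l₁) z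
            + S (l₀ ++ l₁) (majoritySet B l₂) z) ∂D := lintegral_mono hpt
      _ = 2 * (∫⁻ z, S (l₁ ++ l₂) (majoritySet B l₀) z ∂D
            + ∫⁻ z, S (l₀ ++ l₂) (majoritySet B l₁) z ∂D
            + ∫⁻ z, S (l₀ ++ l₁) (majoritySet B l₂) z ∂D) := by
          have m0 := hSm (l₁ ++ l₂) (hM l₀)
          have m1 := hSm (l₀ ++ l₂) (hM l₁)
          have m2 := hSm (l₀ ++ l₁) (hM l₂)
          rw [lintegral_const_mul _ (by fun_prop), lintegral_add_right _ m2,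
            lintegral_add_right _ m1]
      _ ≤ 2 * ((l₁ ++ l₂).length * ENNReal.ofReal ε + (l₀ ++ l₂).length * ENNReal.ofReal ε
            + (l₀ ++ l₁).length * ENNReal.ofReal ε) := by
          gcongr
          · exact lintegral_sum_indicator_le D (hM _) (fun J _ => hB J) h0
          · exact lintegral_sum_indicator_le D (hM _) (fun J _ => hB J) h1
          · exact lintegral_sum_indicator_le D (hM _) (fun J _ => hB J) h2
      _ = N * ENNReal.ofReal (12 * ε) := by
          rw [ENNReal.ofReal_mul (by norm_num)]
          simp only [List.length_append, h₀, h₁, h₂]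
          push_cast
          rw [show ENNReal.ofReal 12 = 12 by simp]
          ring
  rw [ENNReal.mul_le_mul_iff_right (by exact_mod_cast hN.ne') (by finiteness)] at hint
  exact ENNReal.toReal_le_of_le_ofReal (by positivity) hint

/-- The bound of `measure_exists_consistent_le` for a random set `E S` that depends only on the
part of the sample off `P`, and rules that are consistent with the part in `P`. -/
theorem measure_exists_consistent_on_le {W : Type*} [Fintype I] [Countable W]
    {𝓑 : Set (Set Z)} {K β p ε : ℝ} (hK : 0 ≤ K) (hβ : 0 ≤ β) (hβ1 : β ≤ 1) (hε : 0 ≤ ε)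
    (hgrow : GrowthBound 𝓑 K β) (P : Finset I) {E : (I → Z) → Set Z}
    (hE : MeasurableSet {x : (I → Z) × Z | x.2 ∈ E x.1})
    (hEP : ∀ S S' : I → Z, (∀ i ∉ P, S i = S' i) → E S = E S')
    {h : W → (I → Z) → Set Z} (hB : ∀ w S, h w S ∈ 𝓑)
    (hmeas : ∀ w, MeasurableSet {x : (I → Z) × Z | x.2 ∈ h w x.1})
    (hcons : ∀ w S, ∀ i ∈ P, S i ∉ h w S) :
    ENNReal.ofReal ((1 + ε) ^ P.card) * (Measure.pi fun _ : I => D)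
        {S | D.real (E S) ≤ p ∧ ∃ w, ε < D.real (h w S ∩ E S)}
      ≤ ENNReal.ofReal (K * Real.exp (4 * β * p * P.card)) := by
  classical
  set M : Set (I → Z) := {S | D.real (E S) ≤ p ∧ ∃ w, ε < D.real (h w S ∩ E S)} with hMdef
  have hM : MeasurableSet M := by
    have h1 : Measurable fun S => D.real (E S) := (measurable_measure_prodMk_left hE).ennreal_toReal
    have h2 (w : W) : Measurable fun S => D.real (h w S ∩ E S) :=
      (measurable_measure_prodMk_left ((hmeas w).inter hE)).ennreal_toReal
    have : M = {S | D.real (E S) ≤ p} ∩ ⋃ w, {S | ε < D.real (h w S ∩ E S)} := by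
      ext S; simp [hMdef]
    rw [this]
    exact (measurableSet_le h1 measurable_const).inter
      (MeasurableSet.iUnion fun w => measurableSet_lt measurable_const (h2 w))
  obtain ⟨r, hr⟩ : ∃ r : I → Prop, ∀ i, i ∈ P ↔ r i := ⟨(· ∈ P), fun _ => Iff.rfl⟩
  set e := MeasurableEquiv.piEquivPiSubtypeProd (fun _ : I => Z) r with he
  have hmp : MeasurePreserving e.symm _ _ :=
    (measurePreserving_piEquivPiSubtypeProd (fun _ : I => D) r).symm
  have hin (x : {i // r i} → Z) (R : {i // ¬r i} → Z) (i : {i // r i}) :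
      e.symm (x, R) i = x i := by
    have := congrArg (fun y => y.1 i) (e.apply_symm_apply (x, R))
    exact this
  have hout (x : {i // r i} → Z) (R : {i // ¬r i} → Z) (i : {i // ¬r i}) :
      e.symm (x, R) i = R i := by
    have := congrArg (fun y => y.2 i) (e.apply_symm_apply (x, R))
    exact this
  have hsec (R : {i // ¬r i} → Z) : ENNReal.ofReal ((1 + ε) ^ P.card) *
      (Measure.pi fun _ : {i // r i} => D) {x | e.symm (x, R) ∈ M}
        ≤ ENNReal.ofReal (K * Real.exp (4 * β * p * P.card)) := by
    -- Fubini section with the examples off `P` frozen to `R`. The set `E` is then constant, and any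
    -- point of the section certifies that its measure is at most `p`.
    rcases Set.eq_empty_or_nonempty {x | e.symm (x, R) ∈ M} with h0 | ⟨x₀, hx₀⟩
    · rw [h0]; simp
    have hEx (x : {i // r i} → Z) : E (e.symm (x, R)) = E (e.symm (x₀, R)) :=
      hEP _ _ fun i hi => (hout x R ⟨i, mt (hr i).2 hi⟩).trans (hout x₀ R ⟨i, mt (hr i).2 hi⟩).symm
    have hcard : Fintype.card {i // r i} = P.card := Fintype.card_of_subtype P hr
    have hkey := measure_exists_consistent_le (ι := {i // r i}) D hK hβ hβ1 hε hgrow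
      (E := E (e.symm (x₀, R))) (measurable_prodMk_left hE) hx₀.1
      (h := fun w x => h w (e.symm (x, R))) (fun w x => hB w _)
      (fun w => by
        have hm : Measurable fun y : ({i // r i} → Z) × Z => (e.symm (y.1, R), y.2) :=
          (e.symm.measurable.comp (measurable_fst.prodMk measurable_const)).prodMk measurable_snd
        exact hm (hmeas w))
      (fun w x i => by
        have := hcons w (e.symm (x, R)) i ((hr i).2 i.2)
        rwa [hin] at this)
    rw [hcard] at hkey
    refine le_trans ?_ hkey
    gcongr with x
    rintro ⟨-, w, hw⟩
    exact ⟨w, by rwa [← hEx x]⟩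
  rw [← hmp.measure_preimage hM.nullMeasurableSet,
    Measure.prod_apply_symm (hmp.measurable hM), ← lintegral_const_mul _
      (measurable_measure_prodMk_right (hmp.measurable hM))]
  calc _ ≤ ∫⁻ _R : {i // ¬r i} → Z, ENNReal.ofReal (K * Real.exp (4 * β * p * P.card))
        ∂(Measure.pi fun _ => D) := lintegral_mono fun R => hsec R
    _ = _ := by simp

end Majority

/-! ### The error of the recursive majority vote -/

section Recursion

open scoped ENNReal

/-- A rule that assigns to a sample `S` and a set `J` of indices a set of the family `𝓑`, which
depends only on the subsample on `J` and avoids it. -/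
structure IsConsistentRule {Z I : Type*} [MeasurableSpace Z] (𝓑 : Set (Set Z))
    (B : (I → Z) → Finset I → Set Z) : Prop where
  mem : ∀ S J, B S J ∈ 𝓑
  congr : ∀ S S' J, (∀ i ∈ J, S i = S' i) → B S J = B S' J
  notMem : ∀ S J, ∀ i ∈ J, S i ∉ B S J
  measurableSet : ∀ J, MeasurableSet {x : (I → Z) × Z | x.2 ∈ B x.1 J}

/-- The indices `i < m` for which `i + 1` has `l + 1` digits in base `4` and leading digit
`a + 1`. -/
def block (m l a : ℕ) : Finset (Fin m) :=
  Finset.univ.filter fun i => (a + 1) * 4 ^ l ≤ i.1 + 1 ∧ i.1 + 1 < (a + 2) * 4 ^ l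

/-- The overlapping subsamples of the recursive majority vote: at every level, each of the three
recursive calls leaves out one block. -/
def subsamples (m : ℕ) : ℕ → Finset (Fin m) → List (Finset (Fin m))
  | 0, J => [J]
  | k + 1, J =>
    subsamples m k (J ∪ (block m k 1 ∪ block m k 2)) ++
      subsamples m k (J ∪ (block m k 0 ∪ block m k 2)) ++
      subsamples m k (J ∪ (block m k 0 ∪ block m k 1))

lemma length_subsamples (m k : ℕ) (J : Finset (Fin m)) : (subsamples m k J).length = 3 ^ k := by
  induction k generalizing J with
  | zero => rfl
  | succ k ih => simp only [subsamples, List.length_append, ih]; ring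

lemma mem_block {m l a : ℕ} {i : Fin m} :
    i ∈ block m l a ↔ (a + 1) * 4 ^ l ≤ i.1 + 1 ∧ i.1 + 1 < (a + 2) * 4 ^ l := by
  simp [block]

lemma card_block {m l a : ℕ} (ha : a < 3) (hm : 4 ^ (l + 1) ≤ m + 1) :
    (block m l a).card = 4 ^ l := by
  have h4 : 0 < 4 ^ l := by positivity
  have hle : (a + 2) * 4 ^ l ≤ m + 1 := by
    refine le_trans ?_ hm
    rw [pow_succ, mul_comm]
    exact Nat.mul_le_mul_left _ (by omega)
  have hmul : (a + 2) * 4 ^ l = (a + 1) * 4 ^ l + 4 ^ l := by ring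
  have hpos : 0 < (a + 1) * 4 ^ l := by positivity
  have : (block m l a).map Fin.valEmbedding
      = Finset.Ico ((a + 1) * 4 ^ l - 1) ((a + 2) * 4 ^ l - 1) := by
    ext x
    simp only [Finset.mem_map, mem_block, Fin.valEmbedding_apply, Finset.mem_Ico]
    constructor
    · rintro ⟨i, hi, rfl⟩
      omega
    · rintro hx
      exact ⟨⟨x, by omega⟩, by simp only; omega, rfl⟩
  rw [← Finset.card_map Fin.valEmbedding, this, Nat.card_Ico]
  omega

lemma subset_of_mem_subsamples {m k : ℕ} {J J' : Finset (Fin m)} (h : J' ∈ subsamples m k J) :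
    J ⊆ J' := by
  induction k generalizing J with
  | zero =>
    rw [subsamples, List.mem_singleton] at h
    rw [h]
  | succ k ih =>
    simp only [subsamples, List.mem_append] at h
    rcases h with (h | h) | h <;> exact Finset.subset_union_left.trans (ih h)

/-- Deeper levels only add indices from smaller blocks, so a block left out at one level is never
reintroduced below it. -/
lemma mem_or_lt_of_mem_subsamples {m k : ℕ} {J J' : Finset (Fin m)} (h : J' ∈ subsamples m k J)
    {i : Fin m} (hi : i ∈ J') : i ∈ J ∨ i.1 + 1 < 4 ^ k := by
  induction k generalizing J with
  | zero =>
    rw [subsamples, List.mem_singleton] at h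
    exact Or.inl (h ▸ hi)
  | succ k ih =>
    have h4 : 0 < 4 ^ k := by positivity
    simp only [subsamples, List.mem_append] at h
    rw [pow_succ]
    rcases h with (h | h) | h <;>
    · have := ih h
      simp only [Finset.mem_union, mem_block] at this
      by_cases hJ : i ∈ J
      · exact Or.inl hJ
      · right
        simp only [hJ, false_or] at this
        omega

variable {Z : Type*} [MeasurableSpace Z] (D : Measure Z) [IsProbabilityMeasure D]

/-- Turns `(1 + ε) ^ n` into an exponential gain; it follows from `exp y ≤ 1 + y + y²` at `y = x /
2`. -/
lemma exp_half_le_one_add {x : ℝ} (h0 : 0 ≤ x) (h1 : x ≤ 1) : Real.exp (x / 2) ≤ 1 + x := by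
  have := Real.abs_exp_sub_one_sub_id_le (x := x / 2) (by rw [abs_of_nonneg] <;> linarith)
  have := (abs_le.1 this).2
  nlinarith

/-- A vote of rules that do not see the block `P` and the rules that see all of it are rarely wrong
at the same time. -/
lemma measure_overlap_le {I : Type*} [Fintype I] {𝓑 : Set (Set Z)} {B : (I → Z) → Finset I → Set Z}
    (hR : IsConsistentRule 𝓑 B) {Λ η : ℝ} (hΛ : 0 ≤ Λ)
    (hgrow : GrowthBound 𝓑 (Real.exp (14 * Λ)) (1 / 8192)) (hη : 0 < η) (hη1 : η ≤ 1)
    {P : Finset I} {n : ℕ} (hn : 0 < n) (hP : P.card = n) {l l' : List (Finset I)}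
    (hl : ∀ J ∈ l, Disjoint J P) (hl' : ∀ J ∈ l', P ⊆ J)
    (hsmall : 36 * (Λ + Real.log (1 / η)) / n ≤ 1) :
    (Measure.pi fun _ : I => D)
        {S | D.real (majoritySet (B S) l) ≤ 8192 * (Λ + Real.log (1 / η)) / n ∧
          ∃ J ∈ l', 36 * (Λ + Real.log (1 / η)) / n < D.real (B S J ∩ majoritySet (B S) l)}
      ≤ ENNReal.ofReal η := by
  classical
  have hlog : 0 ≤ Real.log (1 / η) := Real.log_nonneg (by rw [le_div_iff₀ hη]; linarith)
  set ℓ := Λ + Real.log (1 / η) with hℓ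
  have hn' : (0 : ℝ) < n := by exact_mod_cast hn
  have hε : 0 ≤ 36 * ℓ / n := by positivity
  have hkey := measure_exists_consistent_on_le D (W := {J // J ∈ l'}) (Real.exp_nonneg _)
    (by norm_num) (by norm_num) hε hgrow P (p := 8192 * ℓ / n)
    (E := fun S => majoritySet (B S) l)
    (measurableSet_majoritySet fun J _ => hR.measurableSet J)
    (fun S S' hSS' => by
      have (J : Finset I) (hJ : J ∈ l) : B S J = B S' J :=
        hR.congr S S' J fun i hi => hSS' i (Finset.disjoint_left.1 (hl J hJ) hi)
      ext z
      simp only [majoritySet, Set.mem_ofPred_eq]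
      rw [List.countP_congr (l := l) (p := fun J => decide (z ∈ B S J))
        (q := fun J => decide (z ∈ B S' J)) fun J hJ => by simp only [this J hJ]])
    (h := fun J S => B S J.1) (fun J S => hR.mem S _) (fun J => hR.measurableSet _)
    (fun J S i hi => hR.notMem S _ i (hl' _ J.2 hi))
  rw [hP] at hkey
  have hexp : Real.exp (18 * ℓ) ≤ (1 + 36 * ℓ / n) ^ n := by
    calc Real.exp (18 * ℓ) = Real.exp (36 * ℓ / n / 2) ^ n := by
          rw [← Real.exp_nat_mul]; congr 1; field_simp; ring
      _ ≤ _ := pow_le_pow_left₀ (Real.exp_nonneg _) (exp_half_le_one_add hε hsmall) n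
  -- With `p = 8192 ℓ / n` and `β = 1/8192` the localization cost `4βpn` is just `4ℓ`. The choice `ε
  -- = 36 ℓ / n` gains `18ℓ`, which pays for `14Λ + 4ℓ` and leaves more than `log (1/η)`.
  have hrhs : Real.exp (14 * Λ) * Real.exp (4 * (1 / 8192) * (8192 * ℓ / n) * n)
      ≤ Real.exp (18 * ℓ) * η := by
    have hηexp : Real.exp (18 * ℓ) * η = Real.exp (18 * ℓ - Real.log (1 / η)) := by
      rw [one_div, Real.log_inv, sub_neg_eq_add, Real.exp_add, Real.exp_log hη]
    rw [hηexp, ← Real.exp_add, Real.exp_le_exp]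
    have : 4 * (1 / 8192) * (8192 * ℓ / n) * n = 4 * ℓ := by field_simp
    rw [this, hℓ]
    linarith
  have hne : ENNReal.ofReal (Real.exp (18 * ℓ)) ≠ 0 := by
    simpa using Real.exp_pos (18 * ℓ)
  rw [← ENNReal.mul_le_mul_iff_right hne ENNReal.ofReal_ne_top]
  calc _ ≤ _ := mul_le_mul_left (ENNReal.ofReal_le_ofReal hexp) _
    _ ≤ _ := by
        refine le_trans ?_ hkey
        refine mul_le_mul' le_rfl (measure_mono ?_)
        rintro S ⟨h1, J, hJ, h2⟩
        exact ⟨h1, ⟨J, hJ⟩, h2⟩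
    _ ≤ _ := ENNReal.ofReal_le_ofReal hrhs
    _ = _ := ENNReal.ofReal_mul (Real.exp_nonneg _)

/-- Induction on `k`. The set `J` collects the blocks inherited from higher levels; its indices lie
beyond the range still to be split, so they do not meet the new blocks. -/
theorem measure_majoritySet_subsamples_le {m : ℕ} {𝓑 : Set (Set Z)}
    {B : (Fin m → Z) → Finset (Fin m) → Set Z} (hR : IsConsistentRule 𝓑 B) {Λ : ℝ}
    (hΛ : Real.log 2 ≤ Λ) (hgrow : GrowthBound 𝓑 (Real.exp (14 * Λ)) (1 / 8192)) (k : ℕ)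
    (hk : 4 ^ k ≤ m + 1) (J : Finset (Fin m)) (hJ : ∀ i ∈ J, 4 ^ k ≤ i.1 + 1) {δ : ℝ} (hδ : 0 < δ)
    (hδ1 : δ ≤ 1) :
    (Measure.pi fun _ : Fin m => D)
        {S | 8192 * (Λ + Real.log (1 / δ)) / 4 ^ k
          < D.real (majoritySet (B S) (subsamples m k J))}
      ≤ ENNReal.ofReal δ := by
  have hlog2 := Real.log_two_gt_d9
  induction k generalizing J δ with
  | zero =>
    have hlog : 0 ≤ Real.log (1 / δ) := Real.log_nonneg (by rw [le_div_iff₀ hδ]; linarith)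
    -- The claimed bound exceeds 1, since `Λ ≥ log 2`.
    refine (measure_mono_null (t := ∅) (fun S hS => ?_) measure_empty).trans_le zero_le
    have h1 : D.real (majoritySet (B S) (subsamples m 0 J)) ≤ 1 := measureReal_le_one
    have h2 : 8192 * (Λ + Real.log (1 / δ)) / 4 ^ 0
      < D.real (majoritySet (B S) (subsamples m 0 J)) := hS
    rw [pow_zero, div_one] at h2
    exact absurd h1 (by linarith)
  | succ k ih =>
    have hlog : 0 ≤ Real.log (1 / δ) := Real.log_nonneg (by rw [le_div_iff₀ hδ]; linarith)
    set n : ℕ := 4 ^ k with hn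
    have hnpos : 0 < n := by positivity
    have hn' : (0 : ℝ) < n := by exact_mod_cast hnpos
    have hk' : 4 ^ k ≤ m + 1 := (Nat.pow_le_pow_right (by norm_num) (Nat.le_succ k)).trans hk
    -- Six bad events share `δ`: three votes that are bad themselves and three overlaps.
    set η := δ / 6 with hη
    have hη0 : 0 < η := by positivity
    have hη1 : η ≤ 1 := by linarith
    set ℓ := Λ + Real.log (1 / η) with hℓ
    -- The loss `log 6 ≤ 3 log 2` is absorbed by `3Λ`.
    have hℓle : ℓ ≤ 4 * (Λ + Real.log (1 / δ)) := by
      have h6 : Real.log (1 / η) = Real.log 6 + Real.log (1 / δ) := by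
        rw [← Real.log_mul (by norm_num) (by positivity), hη]; congr 1; field_simp
      have h8 : Real.log 6 ≤ 3 * Real.log 2 := by
        rw [← Real.log_rpow (by norm_num)]
        exact Real.log_le_log (by norm_num) (by norm_num)
      rw [hℓ, h6]; linarith
    have hℓ0 : 0 ≤ ℓ := by
      have : 0 ≤ Real.log (1 / η) := Real.log_nonneg (by rw [le_div_iff₀ hη0]; linarith)
      rw [hℓ]; linarith
    have hε : 0 ≤ 36 * ℓ / n := by positivity
    -- The induction closes because `12 * 36 * 4 * 4 = 6912 ≤ 8192`: one factor 4 from `hℓle`, the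
    -- other from `4 ^ (k + 1) = 4 n`.
    have hbound : 12 * (36 * ℓ / n) ≤ 8192 * (Λ + Real.log (1 / δ)) / 4 ^ (k + 1) := by
      have : (4 : ℝ) ^ (k + 1) = 4 * n := by rw [hn]; push_cast; ring
      rw [this, ← mul_div_assoc, div_le_div_iff₀ hn' (by positivity)]
      nlinarith
    -- Otherwise `hbound` puts the claimed bound above 1 and the event is empty.
    by_cases hsmall : 36 * ℓ / n ≤ 1
    swap
    · refine (measure_mono_null (t := ∅) (fun S hS => ?_) measure_empty).trans_le zero_le
      have h1 : D.real (majoritySet (B S) (subsamples m (k + 1) J)) ≤ 1 := measureReal_le_one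
      have h2 : 8192 * (Λ + Real.log (1 / δ)) / 4 ^ (k + 1)
        < D.real (majoritySet (B S) (subsamples m (k + 1) J)) := hS
      exact absurd h1 (by linarith)
    set J₀ := J ∪ (block m k 1 ∪ block m k 2) with hJ₀
    set J₁ := J ∪ (block m k 0 ∪ block m k 2) with hJ₁
    set J₂ := J ∪ (block m k 0 ∪ block m k 1) with hJ₂
    have hJblock {a : ℕ} (ha : a < 3) {i : Fin m} (hi : i ∈ J) (hi' : i ∈ block m k a) : False := by
      have h1 := hJ i hi
      have h2 := (mem_block.1 hi').2
      have h3 : (a + 2) * 4 ^ k ≤ 4 * 4 ^ k := Nat.mul_le_mul_right _ (by omega)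
      rw [pow_succ] at h1
      omega
    have hblock {a b : ℕ} (hab : a < b) {i : Fin m} (hi : i ∈ block m k a)
        (hi' : i ∈ block m k b) : False := by
      have h2 := (mem_block.1 hi).2
      have h3 := (mem_block.1 hi').1
      have h4 : (a + 2) * 4 ^ k ≤ (b + 1) * 4 ^ k := Nat.mul_le_mul_right _ (by omega)
      omega
    have hdisj {a : ℕ} {J' : Finset (Fin m)} (h : Disjoint J' (block m k a)) :
        ∀ J'' ∈ subsamples m k J', Disjoint J'' (block m k a) := by
      refine fun J'' hJ'' => Finset.disjoint_left.2 fun i hi hi' => ?_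
      rcases mem_or_lt_of_mem_subsamples hJ'' hi with h1 | h1
      · exact Finset.disjoint_left.1 h h1 hi'
      · have h2 := (mem_block.1 hi').1
        have h3 : 1 * 4 ^ k ≤ (a + 1) * 4 ^ k := Nat.mul_le_mul_right _ (by omega)
        omega
    have hd₀ : Disjoint J₀ (block m k 0) := by
      refine Finset.disjoint_left.2 fun i hi hi' => ?_
      simp only [hJ₀, Finset.mem_union] at hi
      rcases hi with hi | hi | hi
      exacts [hJblock (by norm_num) hi hi', hblock (by norm_num) hi' hi,
        hblock (by norm_num) hi' hi]
    have hd₁ : Disjoint J₁ (block m k 1) := by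
      refine Finset.disjoint_left.2 fun i hi hi' => ?_
      simp only [hJ₁, Finset.mem_union] at hi
      rcases hi with hi | hi | hi
      exacts [hJblock (by norm_num) hi hi', hblock (by norm_num) hi hi',
        hblock (by norm_num) hi' hi]
    have hd₂ : Disjoint J₂ (block m k 2) := by
      refine Finset.disjoint_left.2 fun i hi hi' => ?_
      simp only [hJ₂, Finset.mem_union] at hi
      rcases hi with hi | hi | hi
      exacts [hJblock (by norm_num) hi hi', hblock (by norm_num) hi hi',
        hblock (by norm_num) hi hi']
    have hlarge {a b : ℕ} : ∀ i ∈ J ∪ (block m k a ∪ block m k b), 4 ^ k ≤ i.1 + 1 := by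
      intro i hi
      simp only [Finset.mem_union, mem_block] at hi
      have ha : 1 * 4 ^ k ≤ (a + 1) * 4 ^ k := Nat.mul_le_mul_right _ (by omega)
      have hb : 1 * 4 ^ k ≤ (b + 1) * 4 ^ k := Nat.mul_le_mul_right _ (by omega)
      rcases hi with hi | hi | hi
      · have := hJ i hi
        rw [pow_succ] at this
        omega
      · omega
      · omega
    -- the single votes, and their overlaps
    set bad : Finset (Fin m) → Set (Fin m → Z) := fun J' =>
      {S | 8192 * ℓ / n < D.real (majoritySet (B S) (subsamples m k J'))} with hbad
    set overlap : Finset (Fin m) → List (Finset (Fin m)) → Set (Fin m → Z) := fun J' l' =>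
      {S | D.real (majoritySet (B S) (subsamples m k J')) ≤ 8192 * ℓ / n ∧ ∃ J'' ∈ l',
        36 * ℓ / n < D.real (B S J'' ∩ majoritySet (B S) (subsamples m k J'))} with hoverlap
    set μ := Measure.pi fun _ : Fin m => D with hμ
    have hbadle {J' : Finset (Fin m)} (h : ∀ i ∈ J', 4 ^ k ≤ i.1 + 1) :
        μ (bad J') ≤ ENNReal.ofReal η := by
      have := ih hk' J' h hη0 hη1
      rw [hbad, hn]
      exact_mod_cast this
    have hoverle {a : ℕ} (ha : a < 3) {J' J₁' J₂' : Finset (Fin m)}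
        (h : Disjoint J' (block m k a)) (h1 : block m k a ⊆ J₁') (h2 : block m k a ⊆ J₂') :
        μ (overlap J' (subsamples m k J₁' ++ subsamples m k J₂')) ≤ ENNReal.ofReal η := by
      refine measure_overlap_le D hR (by linarith) hgrow hη0 hη1 hnpos (card_block ha hk)
        (hdisj h) (fun J'' hJ'' => ?_) hsmall
      rcases List.mem_append.1 hJ'' with h' | h'
      · exact h1.trans (subset_of_mem_subsamples h')
      · exact h2.trans (subset_of_mem_subsamples h')
    have hsub {J J' J'' : Finset (Fin m)} : J' ⊆ J ∪ (J' ∪ J'') :=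
      Finset.subset_union_left.trans Finset.subset_union_right
    have hsub' {J J' J'' : Finset (Fin m)} : J'' ⊆ J ∪ (J' ∪ J'') :=
      Finset.subset_union_right.trans Finset.subset_union_right
    have ho₀ := hoverle (by norm_num) hd₀ (hsub : _ ⊆ J₁) (hsub : _ ⊆ J₂)
    have ho₁ := hoverle (by norm_num) hd₁ (hsub : _ ⊆ J₀) (hsub' : _ ⊆ J₂)
    have ho₂ := hoverle (by norm_num) hd₂ (hsub' : _ ⊆ J₀) (hsub' : _ ⊆ J₁)
    have hcover : {S | 8192 * (Λ + Real.log (1 / δ)) / 4 ^ (k + 1)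
          < D.real (majoritySet (B S) (subsamples m (k + 1) J))} ⊆
        (bad J₀ ∪ bad J₁ ∪ bad J₂) ∪ (overlap J₀ (subsamples m k J₁ ++ subsamples m k J₂) ∪
          overlap J₁ (subsamples m k J₀ ++ subsamples m k J₂) ∪
          overlap J₂ (subsamples m k J₀ ++ subsamples m k J₁)) := by
      intro S hS
      by_contra hcon
      simp only [Set.mem_union, not_or, hbad, hoverlap, Set.mem_ofPred_eq, not_lt, not_and,
        not_exists] at hcon
      obtain ⟨⟨⟨b₀, b₁⟩, b₂⟩, ⟨o₀, o₁⟩, o₂⟩ := hcon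
      have := measureReal_majoritySet_append_le D (B := B S)
        (fun J => measurable_prodMk_left (hR.measurableSet J)) (N := 3 ^ k) (by positivity)
        (length_subsamples m k J₀) (length_subsamples m k J₁) (length_subsamples m k J₂) hε
        (o₀ b₀) (o₁ b₁) (o₂ b₂)
      exact absurd (hS.trans_le this) (not_lt.2 hbound)
    have h6 : ENNReal.ofReal δ = ENNReal.ofReal η + ENNReal.ofReal η + ENNReal.ofReal η +
        (ENNReal.ofReal η + ENNReal.ofReal η + ENNReal.ofReal η) := by
      have hδη : δ = η + η + η + (η + η + η) := by rw [hη]; ring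
      conv_lhs => rw [hδη]
      rw [ENNReal.ofReal_add, ENNReal.ofReal_add, ENNReal.ofReal_add] <;> positivity
    rw [h6]
    refine (measure_mono hcover).trans ((measure_union_le _ _).trans (add_le_add ?_ ?_))
    · exact (measure_union_le _ _).trans (add_le_add ((measure_union_le _ _).trans
        (add_le_add (hbadle hlarge) (hbadle hlarge))) (hbadle hlarge))
    · exact (measure_union_le _ _).trans (add_le_add ((measure_union_le _ _).trans
        (add_le_add ho₀ ho₁)) ho₂)

end Recursion

variable {X : Type u} {Step : Type v}

/-! ### Labels -/

lemma stopIndex_mem (h : Verifier X Step) (z : ProblemTrace X Step) :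
    (1 ≤ stopIndex h z ∧ stopIndex h z ≤ z.2.length ∧ h (subtrace z (stopIndex h z)) = false) ∨
      stopIndex h z = z.2.length :=
  Nat.sInf_mem
    (s := {j : ℕ | 1 ≤ j ∧ j ≤ z.2.length ∧ h (subtrace z j) = false} ∪ {z.2.length})
    ⟨_, Or.inr rfl⟩

lemma stopIndex_le_length (h : Verifier X Step) (z : ProblemTrace X Step) :
    stopIndex h z ≤ z.2.length :=
  Nat.sInf_le (Or.inr rfl)

lemma stopIndex_le {h : Verifier X Step} {z : ProblemTrace X Step} {j : ℕ} (hj : 1 ≤ j)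
    (hj' : j ≤ z.2.length) (hh : h (subtrace z j) = false) : stopIndex h z ≤ j :=
  Nat.sInf_le (Or.inl ⟨hj, hj', hh⟩)

lemma eq_true_of_lt_stopIndex {h : Verifier X Step} {z : ProblemTrace X Step} {j : ℕ} (hj : 1 ≤ j)
    (hj' : j < stopIndex h z) : h (subtrace z j) = true := by
  by_contra hh
  have := stopIndex_le hj (hj'.le.trans (stopIndex_le_length h z)) (Bool.eq_false_iff.2 hh)
  omega

lemma eq_false_at_stopIndex {h : Verifier X Step} {z : ProblemTrace X Step} {j : ℕ} (hj : 1 ≤ j)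
    (hj' : j ≤ z.2.length) (hh : h (subtrace z j) = false) :
    1 ≤ stopIndex h z ∧ h (subtrace z (stopIndex h z)) = false := by
  rcases stopIndex_mem h z with h1 | h1
  · exact ⟨h1.1, h1.2.2⟩
  -- The stop index may be the default value `z.2.length`; the rejected prefix `j` is then forced to
  -- be the whole trace.
  · have := stopIndex_le hj hj' hh
    obtain rfl : j = stopIndex h z := by omega
    exact ⟨hj, hh⟩

/-- A verifier errs on a trace if and only if it labels it incorrectly. -/
lemma label_eq_iff_not_errs {hstar h : Verifier X Step} {z : ProblemTrace X Step} :
    label h z = label hstar z ↔ ¬ Errs hstar h z := by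
  simp only [label, Prod.mk.injEq, decide_eq_decide]
  constructor
  · rintro ⟨h1, h2⟩ ⟨j, hj, hjs, hne⟩
    rcases hjs.lt_or_eq with hlt | rfl
    · exact hne ((eq_true_of_lt_stopIndex hj (h2 ▸ hlt)).trans
        (eq_true_of_lt_stopIndex hj hlt).symm)
    · have hlen := stopIndex_le_length hstar z
      by_cases hall : ∀ j, 1 ≤ j → j ≤ z.2.length → hstar (subtrace z j) = true
      · exact hne ((h1.2 hall _ hj hlen).trans (hall _ hj hlen).symm)
      · have hall' := mt h1.1 hall
        push Not at hall hall'
        obtain ⟨i, hi, hi', hf⟩ := hall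
        obtain ⟨i', hi1, hi1', hf'⟩ := hall'
        have e1 := (eq_false_at_stopIndex hi hi' (Bool.eq_false_iff.2 hf)).2
        have e2 := (eq_false_at_stopIndex hi1 hi1' (Bool.eq_false_iff.2 hf')).2
        rw [h2] at e2
        exact hne (e2.trans e1.symm)
  · intro hE
    have hag (j : ℕ) (hj : 1 ≤ j) (hjs : j ≤ stopIndex hstar z) :
        h (subtrace z j) = hstar (subtrace z j) := by
      by_contra hne
      exact hE ⟨j, hj, hjs, hne⟩
    constructor
    · constructor
      · intro hall j hj hj'
        by_contra hf
        obtain ⟨e1, e2⟩ := eq_false_at_stopIndex hj hj' (Bool.eq_false_iff.2 hf)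
        rw [← hag _ e1 le_rfl, hall _ e1 (stopIndex_le_length _ _)] at e2
        exact Bool.noConfusion e2
      · intro hall j hj hj'
        have hs : stopIndex hstar z = z.2.length := by
          rcases stopIndex_mem hstar z with ⟨e1, e2, e3⟩ | e
          · rw [hall _ e1 e2] at e3
            exact Bool.noConfusion e3
          · exact e
        rw [hag j hj (hs ▸ hj'), hall j hj hj']
    · refine le_antisymm ?_ ?_
      · rcases stopIndex_mem hstar z with ⟨e1, e2, e3⟩ | e
        · exact stopIndex_le e1 e2 (by rw [hag _ e1 le_rfl, e3])
        · exact e ▸ stopIndex_le_length h z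
      · rcases stopIndex_mem h z with ⟨e1, e2, e3⟩ | e
        · by_contra hlt
          rw [hag _ e1 (by omega)] at e3
          exact hlt (stopIndex_le e1 e2 e3)
        · exact e ▸ stopIndex_le_length hstar z

/-! ### The number of error patterns -/

-- Since `α ≤ 1`, `α ^ d ≤ α ^ k` for `k ≤ d`; then the binomial theorem applies. A free `α` lets
-- the exponential rate be fixed in advance, at the price of the prefactor.
open Finset in
lemma sum_choose_le {N d : ℕ} {α : ℝ} (hα : 0 < α) (hα1 : α ≤ 1) :
    ((∑ k ∈ Iic d, N.choose k : ℕ) : ℝ) ≤ (1 / α) ^ d * (1 + α) ^ N := by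
  rw [one_div, inv_pow, inv_mul_eq_div, le_div_iff₀ (by positivity)]
  calc ((∑ k ∈ Iic d, N.choose k : ℕ) : ℝ) * α ^ d
      = ∑ k ∈ Iic d, (N.choose k : ℝ) * α ^ d := by push_cast; rw [sum_mul]
    _ ≤ ∑ k ∈ Iic d, (N.choose k : ℝ) * α ^ k := by
        refine sum_le_sum fun k hk => ?_
        gcongr ?_ * ?_
        exact pow_le_pow_of_le_one hα.le hα1 (mem_Iic.1 hk)
    _ ≤ ∑ k ∈ range (N + 1), (N.choose k : ℝ) * α ^ k := by
        rw [sum_subset (s₁ := range (N + 1)) (s₂ := range (max d N + 1))]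
        · refine sum_le_sum_of_subset_of_nonneg (fun k hk => ?_) fun _ _ _ => by positivity
          rw [mem_Iic] at hk
          rw [mem_range]
          omega
        · intro k hk
          simp only [mem_range] at hk ⊢
          omega
        · intro k _ hk
          rw [mem_range] at hk
          rw [Nat.choose_eq_zero_of_lt (by omega), Nat.cast_zero, zero_mul]
    _ = (1 + α) ^ N := by
        rw [add_comm 1 α, add_pow]
        refine sum_congr rfl fun k _ => ?_
        rw [one_pow, mul_one, mul_comm]

lemma card_le_of_shatters {H : Set (Verifier X Step)} {d : ℕ} (hd : vcDim H = d)
    {F : Finset (ProblemTrace X Step)} (hF : Shatters H F) : F.card ≤ d := by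
  have : (F.card : ℕ∞) ≤ vcDim H :=
    le_iSup₂ (f := fun (F : Finset (ProblemTrace X Step)) (_ : Shatters H F) => (F.card : ℕ∞)) F hF
  rw [hd] at this
  exact_mod_cast this

/-- **Sauer–Shelah** for a class of verifiers: few verifiers represent it on a finite set. -/
lemma exists_representatives {H : Set (Verifier X Step)} {d : ℕ} (hd : vcDim H = d)
    (Q : Finset (ProblemTrace X Step)) :
    ∃ R : Finset (Verifier X Step), R.card ≤ ∑ k ∈ Finset.Iic d, Q.card.choose k ∧
      ∀ h ∈ H, ∃ g ∈ R, ∀ x ∈ Q, g x = h x := by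
  classical
  set 𝒜 : Finset (Finset Q) :=
    Finset.univ.filter fun s => ∃ h ∈ H, ∀ x : Q, x ∈ s ↔ h x = true with h𝒜
  have hvc : 𝒜.vcDim ≤ d := by
    refine Finset.sup_le fun s hs => ?_
    rw [Finset.mem_shatterer] at hs
    rw [← Finset.card_map (Function.Embedding.subtype _)]
    refine card_le_of_shatters hd fun G hG => ?_
    have hG' : Finset.univ.filter (fun x : Q => x.1 ∈ G) ⊆ s := by
      intro x hx
      obtain ⟨y, hy, hyx⟩ := Finset.mem_map.1 (hG (Finset.mem_filter.1 hx).2)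
      rwa [← Subtype.ext (a1 := y) (a2 := x) hyx]
    obtain ⟨t, ht, hst⟩ := hs hG'
    obtain ⟨h, hH, hh⟩ := (Finset.mem_filter.1 ht).2
    refine ⟨h, hH, fun z hz => ?_⟩
    obtain ⟨y, hy, rfl⟩ := Finset.mem_map.1 hz
    rw [Function.Embedding.subtype_apply, ← hh y]
    have := Finset.ext_iff.1 hst y
    simpa [hy] using this
  have hcard : 𝒜.card ≤ ∑ k ∈ Finset.Iic d, Q.card.choose k := by
    refine (Finset.card_le_card_shatterer 𝒜).trans
      (Finset.card_shatterer_le_sum_vcDim.trans ?_)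
    rw [Fintype.card_coe]
    exact Finset.sum_le_sum_of_subset (Finset.Iic_subset_Iic.2 hvc)
  -- Each pattern is extended by NO outside `Q`. The result may leave `H`, which does no harm:
  -- representatives are only counted.
  refine ⟨𝒜.image fun s x => decide (∃ hx : x ∈ Q, (⟨x, hx⟩ : Q) ∈ s),
    Finset.card_image_le.trans hcard, fun h hH => ?_⟩
  refine ⟨_, Finset.mem_image_of_mem _
    (a := Finset.univ.filter fun x : Q => h x = true) ?_, fun x hx => ?_⟩
  · simp only [h𝒜, Finset.mem_filter, Finset.mem_univ, true_and]
    exact ⟨h, hH, fun x => Iff.rfl⟩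
  · simp [hx]

lemma errs_congr {hstar g h : Verifier X Step} {z : ProblemTrace X Step}
    (hgh : ∀ j, 1 ≤ j → j ≤ z.2.length → g (subtrace z j) = h (subtrace z j)) :
    Errs hstar g z ↔ Errs hstar h z := by
  refine exists_congr fun j => and_congr_right fun h1 => and_congr_right fun h2 => ?_
  rw [hgh j h1 (h2.trans (stopIndex_le_length _ _))]

/-- The set of points at which the trace `f ω` has length at most `T` and `h` errs. -/
def errorSet {Ω : Type*} (f : Ω → ProblemTrace X Step) (T : ℕ) (hstar h : Verifier X Step) :
    Set Ω :=
  {ω | Errs hstar h (f ω) ∧ (f ω).2.length ≤ T}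

/-- Whether `h` errs on a trace of length at most `T` depends only on its values on at most `T`
prefixes. Sauer–Shelah on these `|F| * T` points with `α = β / T` gives the rate `(1 + β/T) ^ (|F|
T) ≤ exp (β |F|)`. The truncation to length `T` in `errorSet` is what bounds the number of prefixes.
-/
lemma growthBound_errorSet {Ω : Type*} (f : Ω → ProblemTrace X Step) {H : Set (Verifier X Step)}
    {d T : ℕ} (hd : vcDim H = d) (hT : 1 ≤ T) (hstar : Verifier X Step) {β : ℝ} (hβ : 0 < β)
    (hβ1 : β ≤ 1) :
    GrowthBound (errorSet f T hstar '' H) ((T / β) ^ d) β := by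
  classical
  intro F
  have hT' : (1 : ℝ) ≤ T := by exact_mod_cast hT
  set Q : Finset (ProblemTrace X Step) :=
    F.biUnion fun ω => (Finset.Icc 1 T).image (subtrace (f ω)) with hQ
  have hQcard : Q.card ≤ F.card * T := by
    refine Finset.card_biUnion_le_card_mul _ _ _ fun ω _ => Finset.card_image_le.trans ?_
    simp
  obtain ⟨R, hR, hRH⟩ := exists_representatives hd Q
  refine ⟨R.image (errorSet f T hstar), ?_, ?_⟩
  · have hα : 0 < β / T := by positivity
    have hα1 : β / T ≤ 1 := by rw [div_le_one (by positivity)]; linarith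
    calc (((R.image (errorSet f T hstar)).card : ℕ) : ℝ)
        ≤ ((∑ k ∈ Finset.Iic d, Q.card.choose k : ℕ) : ℝ) := by
          exact_mod_cast Finset.card_image_le.trans hR
      _ ≤ (1 / (β / T)) ^ d * (1 + β / T) ^ Q.card := sum_choose_le hα hα1
      _ ≤ (1 / (β / T)) ^ d * Real.exp (β / T) ^ (F.card * T) := by
          gcongr
          calc (1 + β / T) ^ Q.card ≤ (1 + β / T) ^ (F.card * T) :=
                pow_le_pow_right₀ (by linarith) hQcard
            _ ≤ _ := by
                gcongr
                rw [add_comm]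
                exact Real.add_one_le_exp _
      _ = (T / β) ^ d * Real.exp (β * F.card) := by
          rw [one_div_div, ← Real.exp_nat_mul]
          congr 2
          push_cast
          field_simp
  · rintro _ ⟨h, hH, rfl⟩
    obtain ⟨g, hg, hgh⟩ := hRH h hH
    refine ⟨_, Finset.mem_image_of_mem _ hg, fun ω hω => ?_⟩
    refine and_congr_left fun hlen => ?_
    refine (errs_congr fun j h1 h2 => hgh _ ?_).symm
    exact Finset.mem_biUnion.2 ⟨ω, hω, Finset.mem_image_of_mem _
      (Finset.mem_Icc.2 ⟨h1, h2.trans hlen⟩)⟩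

/-- A point on which two members disagree would be shattered. -/
lemma eq_of_vcDim_eq_zero {H : Set (Verifier X Step)} (hd : vcDim H = 0)
    {h h' : Verifier X Step} (hh : h ∈ H) (hh' : h' ∈ H) : h = h' := by
  classical
  by_contra hne
  obtain ⟨z, hz⟩ := Function.ne_iff.1 hne
  have hsh : Shatters H {z} := by
    intro G hG
    have hex (b : Bool) : ∃ g ∈ H, g z = b := by
      by_cases hb : h z = b
      · exact ⟨h, hh, hb⟩
      · refine ⟨h', hh', ?_⟩
        revert hb hz
        cases h z <;> cases h' z <;> cases b <;> simp
    obtain ⟨g, hg, hgz⟩ := hex (decide (z ∈ G))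
    refine ⟨g, hg, fun x hx => ?_⟩
    rw [Finset.mem_singleton.1 hx, hgz, decide_eq_true_iff]
  have := card_le_of_shatters (d := 0) (by simpa using hd) hsh
  simp at this

/-! ### The learner -/

/-- A map that assigns to every finite labelled set a verifier of the class `H` that is consistent
with it, provided that the labels come from a verifier in `H`. -/
def IsConsistentSelector (H : Set (Verifier X Step))
    (sel : Set (ProblemTrace X Step × (Bool × ℕ)) → Verifier X Step) : Prop :=
  ∀ hstar ∈ H, ∀ Q : Set (ProblemTrace X Step × (Bool × ℕ)), Q.Finite →
    (∀ q ∈ Q, label hstar q.1 = q.2) → sel Q ∈ H ∧ ∀ q ∈ Q, label (sel Q) q.1 = q.2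

/-- The pointwise majority vote of the verifiers selected on the subsamples of the first `4 ^ k - 1`
examples, for the largest possible `k`. -/
def voteLearner (sel : Set (ProblemTrace X Step × (Bool × ℕ)) → Verifier X Step) :
    Learner X Step :=
  fun m y x => decide ((subsamples m (Nat.log 4 (m + 1)) ∅).length ≤
    2 * (subsamples m (Nat.log 4 (m + 1)) ∅).countP fun J : Finset (Fin m) =>
      sel (y '' (J : Set (Fin m))) x)

lemma majority_ne {α : Type*} {l : List α} {v : α → Bool} {b : Bool}
    (h : decide (l.length ≤ 2 * l.countP v) ≠ b) :
    l.length ≤ 2 * l.countP (fun J => decide (v J ≠ b)) := by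
  cases b with
  | false =>
    simpa using h
  | true =>
    simp only [ne_eq, decide_eq_true_eq, not_le] at h
    have hlen := List.length_eq_countP_add_countP v (l := l)
    have : l.countP (fun J => decide (v J ≠ true)) = l.countP (fun a => decide ¬ v a = true) := rfl
    omega

-- The range of `j` in `Errs` depends on `hstar` alone. The prefix where the vote is wrong is
-- therefore a legitimate witness for every voter that is wrong there.
open Classical in
lemma le_countP_errs {m : ℕ} {sel : Set (ProblemTrace X Step × (Bool × ℕ)) → Verifier X Step}
    {hstar : Verifier X Step} {y : Fin m → ProblemTrace X Step × (Bool × ℕ)}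
    {z : ProblemTrace X Step} (h : Errs hstar (voteLearner sel m y) z) :
    (subsamples m (Nat.log 4 (m + 1)) ∅).length ≤ 2 *
      (subsamples m (Nat.log 4 (m + 1)) ∅).countP fun J : Finset (Fin m) =>
        decide (Errs hstar (sel (y '' (J : Set (Fin m)))) z) := by
  obtain ⟨j, h1, h2, hne⟩ := h
  refine (majority_ne hne).trans (Nat.mul_le_mul_left 2 (List.countP_mono_left fun J _ hJ => ?_))
  rw [decide_eq_true_iff] at hJ ⊢
  exact ⟨j, h1, h2, hJ⟩

/-- The labelled sample `S`, restricted to the indices in `J`. -/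
def labelledImage {Ω : Type*} (f : Ω → ProblemTrace X Step) (hstar : Verifier X Step) {m : ℕ}
    (S : Fin m → Ω) (J : Finset (Fin m)) : Set (ProblemTrace X Step × (Bool × ℕ)) :=
  (fun i => (f (S i), label hstar (f (S i)))) '' J

/-- Stated for an auxiliary space `Ω` mapped to traces by `f`, so that it covers both the countable
support of a discrete law and the trace space itself. -/
theorem measure_voteLearner_le {Ω : Type*} [MeasurableSpace Ω] (D : Measure Ω)
    [IsProbabilityMeasure D] {f : Ω → ProblemTrace X Step} {H : Set (Verifier X Step)} {d T : ℕ}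
    (hd : vcDim H = d) (hT : 2 ≤ T)
    {sel : Set (ProblemTrace X Step × (Bool × ℕ)) → Verifier X Step}
    (hsel : IsConsistentSelector H sel) {hstar : Verifier X Step} (hstarH : hstar ∈ H)
    (hlen : ∀ᵐ ω ∂D, (f ω).2.length ≤ T) (hlenm : MeasurableSet {ω | (f ω).2.length ≤ T})
    (hmeas : ∀ (m : ℕ) (J : Finset (Fin m)), MeasurableSet {x : (Fin m → Ω) × Ω |
      Errs hstar (sel (labelledImage f hstar x.1 J)) (f x.2)})
    {ε δ : ℝ} (hε : 0 < ε) (hδ : 0 < δ) (hδ1 : δ < 1) {m : ℕ}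
    (hm : 32768 * (1 / ε * (d * Real.log T + Real.log (1 / δ))) ≤ m) :
    (Measure.pi fun _ : Fin m => D) {S | ENNReal.ofReal ε < D {ω | Errs hstar
        (voteLearner sel m fun i => (f (S i), label hstar (f (S i)))) (f ω)}}
      ≤ ENNReal.ofReal δ := by
  classical
  have hcons {m : ℕ} (S : Fin m → Ω) (J : Finset (Fin m)) :=
    hsel hstar hstarH (labelledImage f hstar S J) (J.finite_toSet.image _)
      (by rintro _ ⟨i, _, rfl⟩; rfl)
  -- For `d = 0` the condition `log 2 ≤ Λ` fails, but `H` is then the single verifier `hstar`: every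
  -- voter is correct and so is the vote.
  rcases Nat.eq_zero_or_pos d with rfl | hdpos
  · refine (measure_mono_null (t := ∅) (fun S hS => ?_) measure_empty).trans_le zero_le
    have hnone (ω : Ω) : ¬ Errs hstar
        (voteLearner sel m fun i => (f (S i), label hstar (f (S i)))) (f ω) := by
      intro hE
      have hle := le_countP_errs hE
      have hpos : 0 < (subsamples m (Nat.log 4 (m + 1)) ∅).length := by
        rw [length_subsamples]; positivity
      obtain ⟨J, -, hJ⟩ := List.countP_pos_iff.1
        ((Nat.mul_pos_iff_of_pos_left two_pos).1 (hpos.trans_le hle))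
      rw [decide_eq_true_iff] at hJ
      exact label_eq_iff_not_errs.1 (congrArg (fun g => label g (f ω))
        (eq_of_vcDim_eq_zero (by simpa using hd) (hcons S J).1 hstarH)) hJ
    have hS' : ENNReal.ofReal ε < D {ω | Errs hstar
        (voteLearner sel m fun i => (f (S i), label hstar (f (S i)))) (f ω)} := hS
    rw [Set.eq_empty_of_forall_notMem (s := {ω | Errs hstar _ (f ω)}) hnone, measure_empty] at hS'
    exact absurd hS' not_lt_zero
  set B : (Fin m → Ω) → Finset (Fin m) → Set Ω := fun S J =>
    errorSet f T hstar (sel (labelledImage f hstar S J)) with hB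
  have hR : IsConsistentRule (errorSet f T hstar '' H) B :=
    { mem := fun S J => ⟨_, (hcons S J).1, rfl⟩
      congr := fun S S' J hSS' => by
        have : labelledImage f hstar S J = labelledImage f hstar S' J :=
          Set.image_congr fun i hi => by rw [hSS' i hi]
        simp only [hB, this]
      notMem := fun S J i hi hE =>
        label_eq_iff_not_errs.1 ((hcons S J).2 _ ⟨i, hi, rfl⟩) hE.1
      measurableSet := fun J => (hmeas m J).inter (measurable_snd hlenm) }
  set Λ := d * Real.log T with hΛ
  have hT' : (2 : ℝ) ≤ T := by exact_mod_cast hT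
  have hlogT : Real.log 2 ≤ Real.log T := Real.log_le_log (by norm_num) hT'
  have hlog2 := Real.log_pos (by norm_num : (1 : ℝ) < 2)
  have hd1 : (1 : ℝ) ≤ d := by exact_mod_cast hdpos
  have hΛ2 : Real.log 2 ≤ Λ := by rw [hΛ]; nlinarith
  have hgrow : GrowthBound (errorSet f T hstar '' H) (Real.exp (14 * Λ)) (1 / 8192) := by
    intro F
    obtain ⟨𝒢, h1, h2⟩ := growthBound_errorSet f hd (by omega : 1 ≤ T) hstar
      (β := 1 / 8192) (by norm_num) (by norm_num) F
    refine ⟨𝒢, h1.trans ?_, h2⟩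
    gcongr
    -- Here `8192 = 2 ^ 13`, and `13 log 2 ≤ 13 log T` because `T ≥ 2`; this is the source of the
    -- 14.
    have hlog : Real.log (T / (1 / 8192)) = Real.log T + 13 * Real.log 2 := by
      rw [Real.log_div (by positivity) (by norm_num), one_div, Real.log_inv,
        show (8192 : ℝ) = 2 ^ 13 by norm_num, Real.log_pow]
      push_cast; ring
    rw [← Real.exp_log (show (0 : ℝ) < T / (1 / 8192) by positivity), ← Real.exp_nat_mul,
      Real.exp_le_exp, hlog, hΛ]
    nlinarith
  set k := Nat.log 4 (m + 1) with hk
  have hk1 : 4 ^ k ≤ m + 1 := Nat.pow_log_le_self 4 (by omega)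
  have hk2 : m + 1 < 4 ^ (k + 1) := Nat.lt_pow_succ_log_self (by norm_num) _
  refine le_trans (measure_mono fun S hS => ?_)
    (measure_majoritySet_subsamples_le D hR hΛ2 hgrow k hk1 ∅ (by simp) hδ hδ1.le)
  have hS' : ENNReal.ofReal ε < D {ω | Errs hstar
        (voteLearner sel m fun i => (f (S i), label hstar (f (S i)))) (f ω)} := hS
  have hmono : D {ω | Errs hstar (voteLearner sel m fun i => (f (S i), label hstar (f (S i))))
      (f ω)} ≤ D (majoritySet (B S) (subsamples m k ∅)) := by
    refine measure_mono_ae ?_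
    filter_upwards [hlen] with ω hω hE
    refine (le_countP_errs hE).trans (Nat.mul_le_mul_left 2 (List.countP_mono_left fun J _ hJ => ?_))
    rw [decide_eq_true_iff] at hJ ⊢
    exact ⟨hJ, hω⟩
  have hlt : ε < D.real (majoritySet (B S) (subsamples m k ∅)) :=
    (ENNReal.ofReal_lt_iff_lt_toReal hε.le (by finiteness)).1 (hS'.trans_le hmono)
  refine lt_of_le_of_lt ?_ hlt
  -- By maximality of `k` the vote uses at least a constant fraction of the sample; the lost factor
  -- 4 turns 8192 into 32768.
  have hk3 : (m : ℝ) < 4 * 4 ^ k := by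
    have : m < 4 * 4 ^ k := by rw [pow_succ] at hk2; omega
    exact_mod_cast this
  rw [div_le_iff₀ (by positivity)]
  have : 32768 * (Λ + Real.log (1 / δ)) ≤ m * ε := by
    have := mul_le_mul_of_nonneg_right hm hε.le
    calc 32768 * (Λ + Real.log (1 / δ))
        = 32768 * (1 / ε * (Λ + Real.log (1 / δ))) * ε := by field_simp
      _ ≤ _ := this
  nlinarith

/-! ### Discrete distributions -/

lemma exists_isConsistentSelector (H : Set (Verifier X Step)) :
    ∃ sel, IsConsistentSelector H sel := by
  classical
  refine ⟨fun Q => if h : ∃ g ∈ H, ∀ q ∈ Q, label g q.1 = q.2 then h.choose else fun _ => true,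
    fun hstar hH Q _ hQ => ?_⟩
  have h : ∃ g ∈ H, ∀ q ∈ Q, label g q.1 = q.2 := ⟨hstar, hH, hQ⟩
  simp only [h, dif_pos]
  exact h.choose_spec

/-- The product of full σ-algebras need not be full on an uncountable space. The law is therefore
pulled back to its countable support, where every set is measurable. The inclusions are measurable
embeddings, so they transport the measure of arbitrary sets and an arbitrary consistent selector
will do. -/
theorem exists_learner_discreteLaws (H : Set (Verifier X Step)) {d T : ℕ} (hd : vcDim H = d)
    (hT : 2 ≤ T) :
    ∃ A : Learner X Step, SVPACLearns A H (discreteLaws X Step T)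
      (fun ε δ => 32768 * (1 / ε * (d * Real.log T + Real.log (1 / δ)))) := by
  obtain ⟨sel, hsel⟩ := exists_isConsistentSelector H
  refine ⟨voteLearner sel, ?_⟩
  rintro hstar hH ε δ hε - hδ hδ1 D ⟨p, rfl, hp⟩ m hm
  let _ : MeasurableSpace (ProblemTrace X Step) := ⊤
  let _ : MeasurableSpace p.support := ⊤
  have : Countable p.support := p.support_countable.to_subtype
  have : DiscreteMeasurableSpace p.support := ⟨fun _ => trivial⟩
  have hval : MeasurableEmbedding (Subtype.val : p.support → ProblemTrace X Step) :=
    { injective := Subtype.val_injective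
      measurable := measurable_of_countable _
      measurableSet_image' := fun {_} _ => trivial }
  set D' : Measure p.support := p.toMeasure.comap Subtype.val with hD'
  have hmap : D'.map Subtype.val = p.toMeasure := by
    rw [hD', hval.map_comap, Subtype.range_coe]
    exact Measure.restrict_eq_self_of_ae_mem (by
      rw [ae_iff]
      refine (PMF.toMeasure_apply_eq_zero_iff p trivial).2 ?_
      exact Set.disjoint_left.2 fun z h1 h2 => h2 h1)
  have : IsProbabilityMeasure D' := by
    refine ⟨?_⟩
    rw [← Set.preimage_univ (f := (Subtype.val : p.support → ProblemTrace X Step)),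
      ← hval.map_apply, hmap, measure_univ]
  have hpi : (Measure.pi fun _ : Fin m => p.toMeasure)
      = (Measure.pi fun _ : Fin m => D').map fun S i => (S i).1 := by
    have := Measure.pi_map_pi (μ := fun _ : Fin m => D') (Y := fun _ => ProblemTrace X Step)
      (f := fun _ => Subtype.val) (hμ := fun _ => by rw [hmap]; infer_instance)
      fun _ => hval.measurable.aemeasurable
    rw [this, hmap]
  have hpiemb : MeasurableEmbedding fun (S : Fin m → p.support) i => (S i).1 :=
    { injective := fun S S' h => funext fun i => Subtype.ext (congrFun h i)
      measurable := measurable_of_countable _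
      measurableSet_image' := fun {s} _ => by
        have : MeasurableSingletonClass (ProblemTrace X Step) := ⟨fun _ => trivial⟩
        exact (s.to_countable.image _).measurableSet }
  rw [hpi, hpiemb.map_apply]
  have hkey := measure_voteLearner_le D' (f := Subtype.val) hd hT hsel hH
    (Filter.Eventually.of_forall fun ω => hp _ ω.2) trivial (fun _ _ => MeasurableSet.of_discrete)
    hε hδ hδ1 hm
  refine le_trans (measure_mono fun S hS => ?_) hkey
  have hS' : ENNReal.ofReal ε < p.toMeasure {z | Errs hstar
    (voteLearner sel m fun i => ((S i).1, label hstar (S i).1)) z} := hS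
  rw [← hmap, hval.map_apply] at hS'
  exact hS'

/-! ### Separable classes of measurable verifiers -/

/-- Eliminates `stopIndex`, so that the error event becomes a countable combination of conditions on
single prefixes. -/
lemma errs_iff_exists_le_length {hstar h : Verifier X Step} {z : ProblemTrace X Step} :
    Errs hstar h z ↔ ∃ j, 1 ≤ j ∧ j ≤ z.2.length ∧
      (∀ i, 1 ≤ i → i < j → hstar (subtrace z i) = true) ∧
      h (subtrace z j) ≠ hstar (subtrace z j) := by
  constructor
  · rintro ⟨j, h1, h2, h3⟩
    exact ⟨j, h1, h2.trans (stopIndex_le_length _ _),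
      fun i hi hij => eq_true_of_lt_stopIndex hi (hij.trans_le h2), h3⟩
  · rintro ⟨j, h1, h2, h3, h4⟩
    refine ⟨j, h1, ?_, h4⟩
    rcases stopIndex_mem hstar z with ⟨e1, _, e3⟩ | e
    · by_contra hlt
      rw [h3 _ e1 (by omega)] at e3
      exact Bool.noConfusion e3
    · exact e ▸ h2

/-- A label depends only on finitely many prefixes, so agreement with `hstar` on all prefixes of the
sample suffices. -/
lemma exists_label_eq {H H₀ : Set (Verifier X Step)}
    (hH₀ : ∀ h ∈ H, ∀ F : Finset (ProblemTrace X Step), ∃ h₀ ∈ H₀, ∀ z ∈ F, h₀ z = h z)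
    {hstar : Verifier X Step} (hH : hstar ∈ H) {Q : Set (ProblemTrace X Step × (Bool × ℕ))}
    (hQ : Q.Finite) (hlab : ∀ q ∈ Q, label hstar q.1 = q.2) :
    ∃ h₀ ∈ H₀, ∀ q ∈ Q, label h₀ q.1 = q.2 := by
  classical
  obtain ⟨h₀, hh₀, hag⟩ := hH₀ hstar hH
    (hQ.toFinset.biUnion fun q => (Finset.Icc 1 q.1.2.length).image (subtrace q.1))
  refine ⟨h₀, hh₀, fun q hq => (label_eq_iff_not_errs.2 ?_).trans (hlab q hq)⟩
  rintro ⟨j, h1, h2, hne⟩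
  refine hne (hag _ (Finset.mem_biUnion.2 ⟨q, hQ.mem_toFinset.2 hq, ?_⟩))
  exact Finset.mem_image_of_mem _ (Finset.mem_Icc.2 ⟨h1, h2.trans (stopIndex_le_length _ _)⟩)

open Classical in
/-- The first verifier in the sequence `e` that is consistent with `Q`. -/
noncomputable def firstConsistent (e : ℕ → Verifier X Step)
    (Q : Set (ProblemTrace X Step × (Bool × ℕ))) : Verifier X Step :=
  if h : ∃ n, ∀ q ∈ Q, label (e n) q.1 = q.2 then e (Nat.find h) else fun _ => true

/-! ### Measurability on the space of traces -/

section Measurable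

variable [MeasurableSpace X] [MeasurableSpace Step]

lemma measurable_list_iff {Y : Type*} [MeasurableSpace Y] {f : List Step → Y} :
    Measurable f ↔ ∀ n, Measurable fun v : Fin n → Step => f (List.ofFn v) := by
  refine ⟨fun hf n s hs => ?_, fun hf s hs => ?_⟩
  · exact (MeasurableSpace.measurableSet_iInf.1 (hf hs)) n
  · exact MeasurableSpace.measurableSet_iInf.2 fun n => hf n hs

lemma measurable_ofFn (n : ℕ) : Measurable fun v : Fin n → Step => List.ofFn v :=
  measurable_list_iff.1 measurable_id n

lemma measurable_length : Measurable (List.length : List Step → ℕ) :=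
  measurable_list_iff.2 fun n => by simp

lemma measurable_take (j : ℕ) : Measurable fun l : List Step => l.take j := by
  refine measurable_list_iff.2 fun n => ?_
  -- On sequences of fixed length, truncation is a projection to coordinates.
  have : (fun v : Fin n → Step => (List.ofFn v).take j)
      = fun v => List.ofFn fun i : Fin (min j n) => v (i.castLE (min_le_right j n)) := by
    funext v
    refine List.ext_getElem (by simp) fun i h1 h2 => ?_
    simp
  rw [this]
  exact (measurable_ofFn _).comp (measurable_pi_lambda _ fun i => measurable_pi_apply _)

lemma measurable_subtrace (j : ℕ) :
    Measurable fun z : ProblemTrace X Step => subtrace z j :=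
  measurable_fst.prodMk ((measurable_take j).comp measurable_snd)

lemma measurableSet_errs {hstar h : Verifier X Step} (hstarm : Measurable hstar)
    (hm : Measurable h) : MeasurableSet {z | Errs hstar h z} := by
  simp only [errs_iff_exists_le_length]
  have h1 (j : ℕ) : MeasurableSet {z : ProblemTrace X Step | j ≤ z.2.length} :=
    measurableSet_le measurable_const (measurable_length.comp measurable_snd)
  have h2 (j : ℕ) : MeasurableSet {z | hstar (subtrace z j) = true} :=
    (hstarm.comp (measurable_subtrace j)) (measurableSet_singleton true)
  have h3 (j : ℕ) : MeasurableSet {z | h (subtrace z j) ≠ hstar (subtrace z j)} :=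
    (measurableSet_eq_fun (hm.comp (measurable_subtrace j))
      (hstarm.comp (measurable_subtrace j))).compl
  have : {z : ProblemTrace X Step | ∃ j, 1 ≤ j ∧ j ≤ z.2.length ∧
      (∀ i, 1 ≤ i → i < j → hstar (subtrace z i) = true) ∧
      h (subtrace z j) ≠ hstar (subtrace z j)} =
      ⋃ j, ⋃ (_ : 1 ≤ j), {z | j ≤ z.2.length} ∩
        ((⋂ i, ⋂ (_ : 1 ≤ i), ⋂ (_ : i < j), {z | hstar (subtrace z i) = true}) ∩
          {z | h (subtrace z j) ≠ hstar (subtrace z j)}) := by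
    ext z
    simp only [Set.mem_iUnion, Set.mem_inter_iff, Set.mem_iInter, Set.mem_ofPred_eq, exists_prop]
  rw [this]
  refine MeasurableSet.iUnion fun j => MeasurableSet.iUnion fun _ => (h1 j).inter
    (MeasurableSet.inter ?_ (h3 j))
  exact MeasurableSet.iInter fun i => MeasurableSet.iInter fun _ => MeasurableSet.iInter fun _ =>
    h2 i

theorem exists_learner_boundedLaws (H : Set (Verifier X Step)) {d T : ℕ} (hd : vcDim H = d)
    (hT : 2 ≤ T) (hHm : ∀ h ∈ H, Measurable h) (hsep : PointwiseSeparable H) :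
    ∃ A : Learner X Step, SVPACLearns A H (boundedLaws X Step T)
      (fun ε δ => 32768 * (1 / ε * (d * Real.log T + Real.log (1 / δ)))) := by
  classical
  rcases H.eq_empty_or_nonempty with rfl | ⟨h₁, hh₁⟩
  · exact ⟨fun _ _ _ => true, fun hstar hH => absurd hH (Set.notMem_empty _)⟩
  obtain ⟨H₀, hsub, hcount, hH₀⟩ := hsep
  have hne : H₀.Nonempty := by
    obtain ⟨h₀, hh₀, -⟩ := hH₀ h₁ hh₁ ∅
    exact ⟨h₀, hh₀⟩
  obtain ⟨e, he⟩ := hcount.exists_eq_range hne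
  have heH (n : ℕ) : e n ∈ H := hsub (he ▸ Set.mem_range_self n)
  have hex {hstar : Verifier X Step} (hH : hstar ∈ H)
      {Q : Set (ProblemTrace X Step × (Bool × ℕ))} (hQ : Q.Finite)
      (hlab : ∀ q ∈ Q, label hstar q.1 = q.2) : ∃ n, ∀ q ∈ Q, label (e n) q.1 = q.2 := by
    obtain ⟨h₀, hh₀, hh⟩ := exists_label_eq hH₀ hH hQ hlab
    obtain ⟨n, rfl⟩ := he ▸ hh₀
    exact ⟨n, hh⟩
  have hsel : IsConsistentSelector H (firstConsistent e) := by
    intro hstar hH Q hQ hlab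
    have h := hex hH hQ hlab
    simp only [firstConsistent, h, dif_pos]
    exact ⟨heH _, Nat.find_spec h⟩
  refine ⟨voteLearner (firstConsistent e), ?_⟩
  rintro hstar hH ε δ hε - hδ hδ1 D ⟨hprob, hlen⟩ m hm
  have hstarm := hHm hstar hH
  refine measure_voteLearner_le D (f := id) hd hT hsel hH hlen
    (measurableSet_le (measurable_length.comp measurable_snd) measurable_const)
    (fun m J => ?_) hε hδ hδ1 hm
  have hC (n : ℕ) : MeasurableSet {x : (Fin m → ProblemTrace X Step) × ProblemTrace X Step |
      ∀ q ∈ labelledImage id hstar x.1 J, label (e n) q.1 = q.2} := by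
    have : {x : (Fin m → ProblemTrace X Step) × ProblemTrace X Step |
        ∀ q ∈ labelledImage id hstar x.1 J, label (e n) q.1 = q.2} =
        ⋂ i ∈ J, {x | ¬ Errs hstar (e n) (x.1 i)} := by
      ext x
      simp [labelledImage, label_eq_iff_not_errs]
    rw [this]
    refine Finset.measurableSet_biInter _ fun i _ => MeasurableSet.compl ?_
    have hpr : Measurable fun x : (Fin m → ProblemTrace X Step) × ProblemTrace X Step => x.1 i := by
      fun_prop
    exact hpr (measurableSet_errs hstarm (hHm _ (heH n)))
  -- The event is split according to the index of the first consistent verifier; on each piece the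
  -- verifier is fixed.
  have heq : {x : (Fin m → ProblemTrace X Step) × ProblemTrace X Step |
      Errs hstar (firstConsistent e (labelledImage id hstar x.1 J)) (id x.2)} =
      ⋃ n, {x | ∀ q ∈ labelledImage id hstar x.1 J, label (e n) q.1 = q.2} ∩
        ((⋂ n', ⋂ (_ : n' < n),
          {x | ∀ q ∈ labelledImage id hstar x.1 J, label (e n') q.1 = q.2}ᶜ) ∩
          {x | Errs hstar (e n) x.2}) := by
    ext x
    have h := hex hH (Q := labelledImage id hstar x.1 J) (J.finite_toSet.image _)
      (by rintro _ ⟨i, _, rfl⟩; rfl)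
    have hfc : firstConsistent e (labelledImage id hstar x.1 J) = e (Nat.find h) := by
      simp only [firstConsistent, h, dif_pos]
    rw [Set.mem_ofPred_eq, hfc]
    simp only [Set.mem_iUnion, Set.mem_inter_iff, Set.mem_iInter, Set.mem_compl_iff,
      Set.mem_ofPred_eq]
    constructor
    · exact fun hE => ⟨Nat.find h, Nat.find_spec h, fun n' hn' => Nat.find_min h hn', hE⟩
    · rintro ⟨n, h1, h2, h3⟩
      rwa [(Nat.find_eq_iff h).2 ⟨h1, h2⟩]
  rw [heq]
  refine MeasurableSet.iUnion fun n => (hC n).inter (MeasurableSet.inter ?_ ?_)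
  · exact MeasurableSet.iInter fun n' => MeasurableSet.iInter fun _ => (hC n').compl
  · exact measurable_snd (measurableSet_errs hstarm (hHm _ (heH n)))

end Measurable

end SVPAC

/-! ### Both cases with one absolute constant -/

theorem mainTheorem1 :
    ∃ C : ℝ, 0 < C ∧
      ∀ (X : Type*) (Step : Type*) (H : Set (SVPAC.Verifier X Step)) (d T : ℕ),
        SVPAC.vcDim H = (d : ℕ∞) → 2 ≤ T →
        (∃ A : SVPAC.Learner X Step,
          SVPAC.SVPACLearns A H (SVPAC.discreteLaws X Step T)
            (fun ε δ => C * (1 / ε * (d * Real.log T + Real.log (1 / δ))))) ∧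
        (∀ [MeasurableSpace X] [MeasurableSpace Step],
          (∀ h ∈ H, Measurable h) → SVPAC.PointwiseSeparable H →
          ∃ A : SVPAC.Learner X Step,
            SVPAC.SVPACLearns A H (SVPAC.boundedLaws X Step T)
              (fun ε δ => C * (1 / ε * (d * Real.log T + Real.log (1 / δ))))) :=
  ⟨32768, by norm_num, fun _ _ H _ _ hd hT =>
    ⟨SVPAC.exists_learner_discreteLaws H hd hT,
      fun hHm hsep => SVPAC.exists_learner_boundedLaws H hd hT hHm hsep⟩⟩
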